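/- **The calculus.** HF is the first-order theory of hereditarily finite sets with a constant $0$, a binary function symbol $\lhd$ (where $x\lhd y$ denotes $x\cup\{y\}$), and the relations $\in$ and $=$. Formulas are built with $\lor,\neg,\exists$ and identified up to renaming of bound variables. The calculus is a Hilbert system $H\vdash\phi$ ($H$ a set of hypotheses) with propositional axioms, equality axioms, the axioms $\phi(t)\to\exists x\,\phi$, the axioms $$z=0\leftrightarrow\forall x\,(x\notin z),\qquad z=x\lhd y\leftrightarrow\forall u\,(u\in z\leftrightarrow u\in x\lor u=y),$$ the induction scheme $\phi(0)\land\forall x\,y\,(\phi(x)\land\phi(y)\to\phi(x\lhd y))\to\forall x\,\phi(x)$, one further fixed but arbitrary formula as an extra axiom, modus ponens, the existential rule, and substitution of terms for variables (in the last two rules the variable must not be free in $H$). **Coding.** Ordered pairs are $\{\{x\},\{x,y\}\}$. Terms and formulas are coded by constant terms, with de Bruijn indices for bound variables: $\ulcorner 0\urcorner=0$, the $i$-th variable is coded by the $i$-th positive ordinal, $\ulcorner t\lhd u\urcorner=\langle\ulcorner\lhd\urcorner,\ulcorner t\urcorner,\ulcorner u\urcorner\rangle$, $\ulcorner t\in u\urcorner=\langle\ulcorner\in\urcorner,\ulcorner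 t\urcorner,\ulcorner u\urcorner\rangle$, and so on. $\lfloor\alpha\rfloor_V$ denotes the code of $\alpha$ in which the free variables from the set $V$ are kept as variables instead of being coded. $\mathrm{Pf}(y)$ is the formula of HF stating that there is a finite sequence which is a coded proof (in the calculus above, without hypotheses) whose last line is $y$. **The relation $\mathrm{QR}$.** $\mathrm{QR}(x,x')$ is the formula of HF stating that there are an ordinal $k$ and a sequence $s$, defined at least on the ordinals up to $k$, such that the entry of $s$ at $k$ is $\langle x,x'\rangle$ and, for each $l\le k$, the entry of $s$ at $l$ either is $\langle 0,0\rangle$ or is $\langle a\lhd b,\langle\ulcorner\lhd\urcorner,a',b'\rangle\rangle$ for some entries $\langle a,a'\rangle$, $\langle b,b'\rangle$ of $s$ at positions in $l$. (No ordering of the sets enters this definition, and $\mathrm{QR}$ is not required to be functional.) **Theorem.** Write $t\subseteq u$ for $\forall z\,(z\in t\to z\in u)$. For all variables $x,x',y,y'$ the HF calculus proves $$\mathrm{QR}(x,x'),\ \mathrm{QR}(y,y')\ \vdash\ x\in y\to\mathrm{Pf}\,\lfloor x'\in y'\rfloor_{\{x',y'\}},$$ $$\mathrm{QR}(x,x'),\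 \mathrm{QR}(y,y')\ \vdash\ x\subseteq y\to\mathrm{Pf}\,\lfloor x'\subseteq y'\rfloor_{\{x',y'\}},$$ $$\mathrm{QR}(x,x'),\ \mathrm{QR}(y,y')\ \vdash\ x=y\to\mathrm{Pf}\,\lfloor x'=y'\rfloor_{\{x',y'\}}.$$ -/

import Mathlib

namespace HFCalc

/-! ## Syntax

Formulas are taken up to renaming of bound variables: a free variable is a name `i : ℕ`, a bound
variable is a de Bruijn index (`0` for the innermost quantifier).  `Tm n` and `Fm n` contain only
bound indices `< n`, so that the terms and formulas of the calculus are `Tm 0` and `Fm 0`. -/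

inductive Tm (n : ℕ) : Type
  | zero : Tm n
  | var (i : ℕ) : Tm n
  | bnd (k : Fin n) : Tm n
  | eats (t u : Tm n) : Tm n

inductive Fm : ℕ → Type
  | mem {n : ℕ} (t u : Tm n) : Fm n
  | eq {n : ℕ} (t u : Tm n) : Fm n
  | disj {n : ℕ} (A B : Fm n) : Fm n
  | neg {n : ℕ} (A : Fm n) : Fm n
  | ex {n : ℕ} (A : Fm (n + 1)) : Fm n

abbrev Term : Type := Tm 0
abbrev Form : Type := Fm 0

/-- The variable with name `i`; where a term is expected, a name stands for the variable. -/
abbrev v (i : ℕ) : Term := Tm.var i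

instance : Coe ℕ Term := ⟨Tm.var⟩

/-- The set of (names of) free variables. -/
def Tm.fv {n : ℕ} : Tm n → Finset ℕ
  | .zero => ∅
  | .var i => {i}
  | .bnd _ => ∅
  | .eats t u => t.fv ∪ u.fv

def Fm.fv : {n : ℕ} → Fm n → Finset ℕ
  | _, .mem t u => t.fv ∪ u.fv
  | _, .eq t u => t.fv ∪ u.fv
  | _, .disj A B => A.fv ∪ B.fv
  | _, .neg A => A.fv
  | _, .ex A => A.fv

/-- A term of the calculus, used inside the scope of `n` quantifiers. -/
def Tm.lift (n : ℕ) : Tm 0 → Tm n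
  | .zero => .zero
  | .var i => .var i
  | .bnd k => k.elim0
  | .eats t u => .eats (t.lift n) (u.lift n)

/-- Simultaneous substitution of `σ i` for each free variable `i`. -/
def Tm.subst (σ : ℕ → Term) {n : ℕ} : Tm n → Tm n
  | .zero => .zero
  | .var i => (σ i).lift n
  | .bnd k => .bnd k
  | .eats t u => .eats (t.subst σ) (u.subst σ)

def Fm.subst (σ : ℕ → Term) : {n : ℕ} → Fm n → Fm n
  | _, .mem t u => .mem (t.subst σ) (u.subst σ)
  | _, .eq t u => .eq (t.subst σ) (u.subst σ)
  | _, .disj A B => .disj (A.subst σ) (B.subst σ)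
  | _, .neg A => .neg (A.subst σ)
  | _, .ex A => .ex (A.subst σ)

/-- `A(i ::= x)`. -/
def Fm.sub (A : Form) (i : ℕ) (x : Term) : Form :=
  A.subst (Function.update Tm.var i x)

/-- Abstraction: the name `i` becomes the (outermost) bound index `n`. -/
def Tm.abst (i : ℕ) {n : ℕ} : Tm n → Tm (n + 1)
  | .zero => .zero
  | .var j => if j = i then .bnd (Fin.last n) else .var j
  | .bnd k => .bnd k.castSucc
  | .eats t u => .eats (t.abst i) (u.abst i)

def Fm.abst (i : ℕ) : {n : ℕ} → Fm n → Fm (n + 1)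
  | _, .mem t u => .mem (t.abst i) (u.abst i)
  | _, .eq t u => .eq (t.abst i) (u.abst i)
  | _, .disj A B => .disj (A.abst i) (B.abst i)
  | _, .neg A => .neg (A.abst i)
  | _, .ex A => .ex (A.abst i)

/-! ### Connectives and quantifiers -/

abbrev Zero : Term := Tm.zero
abbrev Eats (t u : Term) : Term := Tm.eats t u
abbrev Mem (t u : Term) : Form := Fm.mem t u
abbrev Equ (t u : Term) : Form := Fm.eq t u
abbrev Disj (A B : Form) : Form := Fm.disj A B
abbrev Neg (A : Form) : Form := Fm.neg A
def Conj (A B : Form) : Form := Neg (Disj (Neg A) (Neg B))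
def Imp (A B : Form) : Form := Disj (Neg A) B
def Biimp (A B : Form) : Form := Conj (Imp A B) (Imp B A)

infix:60 " IN " => Mem
infix:60 " EQ " => Equ
infixr:50 " AND " => Conj
infixr:45 " OR " => Disj
infixr:40 " IMP " => Imp
infix:35 " IFF " => Biimp

/-- `∃ i, A`, for a variable name `i`. -/
def Ex (i : ℕ) (A : Form) : Form := Fm.ex (A.abst i)

def Exs (is : List ℕ) (A : Form) : Form := is.foldr Ex A

def All (i : ℕ) (A : Form) : Form := Neg (Ex i (Neg A))

/-- `∀ i ∈ t, A`; used only for `i` not free in `t`. -/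
def All2 (i : ℕ) (t : Term) (A : Form) : Form := All i (i IN t IMP A)

/-! ## The HF calculus -/

inductive BooleanAxiom : Form → Prop
  | ident (A : Form) : BooleanAxiom (A IMP A)
  | disjI (A B : Form) : BooleanAxiom (A IMP (A OR B))
  | disjCont (A : Form) : BooleanAxiom ((A OR A) IMP A)
  | disjAssoc (A B C : Form) : BooleanAxiom ((A OR (B OR C)) IMP ((A OR B) OR C))
  | disjConj (A B C : Form) : BooleanAxiom ((C OR A) IMP ((Neg C OR B) IMP (A OR B)))

/-- The instances of these axioms for other terms follow by the substitution rule. -/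
def reflAx : Form := v 1 EQ v 1
def eqCongAx : Form :=
  (v 1 EQ v 2 AND v 3 EQ v 4) IMP (v 1 EQ v 3 IMP v 2 EQ v 4)
def memCongAx : Form :=
  (v 1 EQ v 2 AND v 3 EQ v 4) IMP (v 1 IN v 3 IMP v 2 IN v 4)
def eatsCongAx : Form :=
  (v 1 EQ v 2 AND v 3 EQ v 4) IMP (Eats (v 1) (v 3) EQ Eats (v 2) (v 4))

inductive EqualityAxiom : Form → Prop
  | refl : EqualityAxiom reflAx
  | eqCong : EqualityAxiom eqCongAx
  | memCong : EqualityAxiom memCongAx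
  | eatsCong : EqualityAxiom eatsCongAx

/-- `z = 0 ↔ ∀ x, x ∉ z`. -/
def hf1 : Form := (v 0 EQ Zero) IFF All 1 (Neg (v 1 IN v 0))

/-- `z = x ◁ y ↔ ∀ u, u ∈ z ↔ u ∈ x ∨ u = y`. -/
def hf2 : Form :=
  (v 0 EQ Eats (v 1) (v 2)) IFF All 3 ((v 3 IN v 0) IFF (v 3 IN v 1 OR v 3 EQ v 2))

inductive HFAxiom : Form → Prop
  | hf1 : HFAxiom hf1
  | hf2 : HFAxiom hf2

inductive SpecialAxiom : Form → Prop
  | spec (A : Form) (i : ℕ) (x : Term) : SpecialAxiom (A.sub i x IMP Ex i A)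

inductive InductionAxiom : Form → Prop
  | ind (A : Form) (i j : ℕ) (hij : i ≠ j) (hj : j ∉ A.fv) :
      InductionAxiom
        (A.sub i Zero IMP
          (All i (All j (A IMP (A.sub i (v j) IMP A.sub i (Eats (v i) (v j)))))
            IMP All i A))

/-- `Thm extra H A`: the formula `A` is provable from the set `H` of formulas, in the HF calculus
with the additional axiom `extra`. -/
inductive Thm (extra : Form) : Set Form → Form → Prop
  | hyp {H : Set Form} {A : Form} : A ∈ H → Thm extra H A
  | extra {H : Set Form} : Thm extra H extra
  | bool {H : Set Form} {A : Form} : BooleanAxiom A → Thm extra H A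
  | eq {H : Set Form} {A : Form} : EqualityAxiom A → Thm extra H A
  | spec {H : Set Form} {A : Form} : SpecialAxiom A → Thm extra H A
  | hf {H : Set Form} {A : Form} : HFAxiom A → Thm extra H A
  | ind {H : Set Form} {A : Form} : InductionAxiom A → Thm extra H A
  | mp {H H' : Set Form} {A B : Form} :
      Thm extra H (A IMP B) → Thm extra H' A → Thm extra (H ∪ H') B
  | exist {H : Set Form} {A B : Form} {i : ℕ} :
      Thm extra H (A IMP B) → i ∉ B.fv → (∀ C ∈ H, i ∉ C.fv) → Thm extra H (Ex i A IMP B)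
  | subst {H : Set Form} {A : Form} {i : ℕ} {x : Term} :
      Thm extra H A → (∀ C ∈ H, i ∉ C.fv) → Thm extra H (A.sub i x)

/-! ## Coding of terms and formulas -/

/-- Successor `x ◁ x`. -/
def succ (x : Term) : Term := Eats x x

def ordOf : ℕ → Term
  | 0 => Zero
  | k + 1 => succ (ordOf k)

/-- The ordered pair `{{x}, {x, y}}`. -/
def HPair (x y : Term) : Term :=
  Eats (Eats Zero (Eats Zero x)) (Eats (Eats Zero x) y)

/-- Constant terms serving as codes of the symbols. -/
def HTuple : ℕ → Term
  | 0 => HPair Zero Zero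
  | k + 1 => HPair Zero (HTuple k)

def QMem (t u : Term) : Term := HPair (HTuple 0) (HPair t u)
def QEats (t u : Term) : Term := HPair (HTuple 1) (HPair t u)
def QEq (t u : Term) : Term := HPair (HTuple 2) (HPair t u)
def QDisj (t u : Term) : Term := HPair (HTuple 3) (HPair t u)
def QNeg (t : Term) : Term := HPair (HTuple 4) t
def QEx (t : Term) : Term := HPair (HTuple 5) t
def QInd (k : Term) : Term := HPair (HTuple 6) k

def QImp (t u : Term) : Term := QDisj (QNeg t) u
def QAll (t : Term) : Term := QNeg (QEx (QNeg t))

/-- Pseudo-coding: the variables in `V` are preserved, everything else is coded by constant terms;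
in particular the free variable `i ∉ V` is coded by the ordinal `i + 1`. -/
def Tm.vquot (V : Finset ℕ) : {n : ℕ} → Tm n → Term
  | _, .zero => Zero
  | _, .var i => if i ∈ V then v i else ordOf (i + 1)
  | _, .bnd k => QInd (ordOf k)
  | _, .eats t u => QEats (t.vquot V) (u.vquot V)

def Fm.vquot (V : Finset ℕ) : {n : ℕ} → Fm n → Term
  | _, .mem t u => QMem (t.vquot V) (u.vquot V)
  | _, .eq t u => QEq (t.vquot V) (u.vquot V)
  | _, .disj A B => QDisj (A.vquot V) (B.vquot V)
  | _, .neg A => QNeg (A.vquot V)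
  | _, .ex A => QEx (A.vquot V)

/-- The code of a formula. -/
def Fm.quot (A : Form) : Term := A.vquot ∅

/-! ## Predicates of the calculus

Every predicate is given as a formula `…Body` in variable names, where the first arguments name the
parameters and the remaining ones name the bound variables.  It is applied to terms by
capture-avoiding substitution for the parameters. -/

/-- Substitute the `i`-th entry of `l` for the variable `i`, for every `i < l.length`. -/
def inst (A : Form) (l : List Term) : Form :=
  A.subst fun i => l.getD i (v i)

/-- `∀ z ∈ x, z ∈ y`. -/
def subsetBody (x y z : ℕ) : Form := All2 z x (z IN y)
def Subset (t u : Term) : Form := inst (subsetBody 0 1 2) [t, u]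

infix:60 " SUBS " => Subset

/-- `x` is an ordinal: a transitive set of transitive sets. -/
def ordBody (x y z : ℕ) : Form := All2 y x (y SUBS x AND All2 z y (z SUBS y))
def OrdP (x : Term) : Form := inst (ordBody 0 1 2) [x]

/-- `x` and `y` are distinct ordinals. -/
def OrdNeP (x y : Term) : Form := OrdP x AND OrdP y AND (x IN y OR y IN x)

/-- `x` is the code of a variable: a nonzero ordinal. -/
def VarP (x : Term) : Form := OrdP x AND Zero IN x

/-! ### Sequences -/

/-- The members of `r` are pairs with an ordinal as first component, and `r` is single-valued. -/
def hfunBody (r z z' x y x' y' : ℕ) : Form :=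
  All2 z r (All2 z' r (Exs [x, y, x', y']
    (z EQ HPair x y AND z' EQ HPair x' y' AND OrdP x AND OrdP x' AND
      (OrdNeP x x' OR y EQ y'))))
def HFunP (r : Term) : Form := inst (hfunBody 0 1 2 3 4 5 6) [r]

/-- Every member of `d` is in the domain of `r`. -/
def domInclBody (r d x y : ℕ) : Form := All2 x d (Ex y (HPair x y IN r))
def DomInclP (r d : Term) : Form := inst (domInclBody 0 1 2 3) [r, d]

/-- `s` is a sequence defined (at least) on the ordinals `0, …, k`, with last entry `y` at `k`. -/
def LstSeqP (s k y : Term) : Form :=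
  OrdP k AND DomInclP s (succ k) AND HFunP s AND HPair k y IN s

/-! ### The relation `QR` -/

/-- `s` is a sequence with last entry `⟨t, u⟩` at `k`, each of whose entries is `⟨0, 0⟩` or is
`⟨a ◁ b, ⟨⌜◁⌝, a', b'⟩⟩` for two earlier entries `⟨a, a'⟩` and `⟨b, b'⟩`. -/
def seqQRBody (t u s k l a a' m n b b' c c' : ℕ) : Form :=
  LstSeqP s k (HPair t u) AND
  All2 l (succ k) (Exs [a, a'] (HPair l (HPair a a') IN s AND
    ((a EQ Zero AND a' EQ Zero) OR
      Exs [m, n, b, b', c, c'] (m IN l AND n IN l AND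
        HPair m (HPair b b') IN s AND HPair n (HPair c c') IN s AND
        a EQ Eats b c AND a' EQ QEats b' c'))))
def SeqQR (t u s k : Term) : Form :=
  inst (seqQRBody 0 1 2 3 4 5 6 7 8 9 10 11 12) [t, u, s, k]

def qrBody (t u s k : ℕ) : Form := Exs [s, k] (SeqQR t u s k)
/-- `QR(t, u)`: `u` is the code of a constant term denoting the set `t`. -/
def QR (t u : Term) : Form := inst (qrBody 0 1 2 3) [t, u]

/-! ### Codes of terms -/

def seqTermBody (t s k l a m n b c : ℕ) : Form :=
  LstSeqP s k t AND
  All2 l (succ k) (Ex a (HPair l a IN s AND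
    (a EQ Zero OR VarP a OR
      Exs [m, n, b, c] (m IN l AND n IN l AND HPair m b IN s AND HPair n c IN s AND
        a EQ QEats b c))))
def SeqTermP (t s k : Term) : Form := inst (seqTermBody 0 1 2 3 4 5 6 7 8) [t, s, k]

def termBody (t s k : ℕ) : Form := Exs [s, k] (SeqTermP t s k)
/-- `t` is the code of a term (without bound indices). -/
def TermP (t : Term) : Form := inst (termBody 0 1 2) [t]

def indBody (t k : ℕ) : Form := Ex k (OrdP k AND t EQ QInd k)
/-- `t` is the code of a bound index. -/
def IndP (t : Term) : Form := inst (indBody 0 1) [t]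

/-- In each entry `⟨a, a'⟩` of the sequence `s`, `a'` results from the (possibly open) term coded
by `a` by replacing the variable `x` by `u`; the last entry is `⟨t, t'⟩`. -/
def seqStTermBody (x u t t' s k l a a' m n b b' c c' : ℕ) : Form :=
  LstSeqP s k (HPair t t') AND
  All2 l (succ k) (Exs [a, a'] (HPair l (HPair a a') IN s AND
    ((a EQ x AND a' EQ u) OR
      ((IndP a OR OrdNeP a x) AND a' EQ a) OR
      Exs [m, n, b, b', c, c'] (m IN l AND n IN l AND
        HPair m (HPair b b') IN s AND HPair n (HPair c c') IN s AND
        a EQ QEats b c AND a' EQ QEats b' c'))))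
def SeqStTermP (x u t t' s k : Term) : Form :=
  inst (seqStTermBody 0 1 2 3 4 5 6 7 8 9 10 11 12 13 14) [x, u, t, t', s, k]

def substTermBody (x u t t' s k : ℕ) : Form :=
  VarP x AND TermP u AND Exs [s, k] (SeqStTermP x u t t' s k)
/-- `t'` results from `t` by substituting the term `u` for the variable `x`. -/
def SubstTermP (x u t t' : Term) : Form := inst (substTermBody 0 1 2 3 4 5) [x, u, t, t']

def abstTermBody (x i t t' s k : ℕ) : Form :=
  VarP x AND OrdP i AND Exs [s, k] (SeqStTermP x (QInd i) t t' s k)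
/-- `t'` results from `t` by abstracting the variable `x` to the bound index `i`. -/
def AbstTermP (x i t t' : Term) : Form := inst (abstTermBody 0 1 2 3 4 5) [x, i, t, t']

/-! ### Substitution and abstraction on codes of formulas -/

def substAtomicBody (x w y y' t u t' u' : ℕ) : Form :=
  Exs [t, u, t', u'] (SubstTermP x w t t' AND SubstTermP x w u u' AND
    ((y EQ QEq t u AND y' EQ QEq t' u') OR (y EQ QMem t u AND y' EQ QMem t' u')))
def SubstAtomicP (x w y y' : Term) : Form :=
  inst (substAtomicBody 0 1 2 3 4 5 6 7) [x, w, y, y']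

def seqSubstFormBody (x w y y' s k l a a' m n b b' c c' : ℕ) : Form :=
  LstSeqP s k (HPair y y') AND
  All2 l (succ k) (Exs [a, a'] (HPair l (HPair a a') IN s AND
    (SubstAtomicP x w a a' OR
      Exs [m, n, b, b', c, c'] (m IN l AND n IN l AND
        HPair m (HPair b b') IN s AND HPair n (HPair c c') IN s AND
        ((a EQ QDisj b c AND a' EQ QDisj b' c') OR
          (a EQ QNeg b AND a' EQ QNeg b') OR
          (a EQ QEx b AND a' EQ QEx b'))))))
def SeqSubstFormP (x w y y' s k : Term) : Form :=
  inst (seqSubstFormBody 0 1 2 3 4 5 6 7 8 9 10 11 12 13 14) [x, w, y, y', s, k]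

def substFormBody (x w y y' s k : ℕ) : Form :=
  VarP x AND TermP w AND Exs [s, k] (SeqSubstFormP x w y y' s k)
/-- `y'` results from `y` by substituting the term `w` for the variable `x`. -/
def SubstFormP (x w y y' : Term) : Form := inst (substFormBody 0 1 2 3 4 5) [x, w, y, y']

def abstAtomicBody (x i y y' t u t' u' : ℕ) : Form :=
  Exs [t, u, t', u'] (AbstTermP x i t t' AND AbstTermP x i u u' AND
    ((y EQ QEq t u AND y' EQ QEq t' u') OR (y EQ QMem t u AND y' EQ QMem t' u')))
def AbstAtomicP (x i y y' : Term) : Form :=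
  inst (abstAtomicBody 0 1 2 3 4 5 6 7) [x, i, y, y']

/-- The entries are triples `⟨j, ⟨a, a'⟩⟩`: `a'` results from `a` by abstracting `x` to the bound
index `j`, which increases by one below each quantifier. -/
def seqAbstFormBody (x i y y' s k l j a a' m n jb b b' jc c c' : ℕ) : Form :=
  LstSeqP s k (HPair i (HPair y y')) AND
  All2 l (succ k) (Exs [j, a, a'] (HPair l (HPair j (HPair a a')) IN s AND
    (AbstAtomicP x j a a' OR
      (OrdP j AND Exs [m, n, jb, b, b', jc, c, c'] (m IN l AND n IN l AND
        HPair m (HPair jb (HPair b b')) IN s AND HPair n (HPair jc (HPair c c')) IN s AND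
        ((jb EQ j AND jc EQ j AND a EQ QDisj b c AND a' EQ QDisj b' c') OR
          (jb EQ j AND a EQ QNeg b AND a' EQ QNeg b') OR
          (jb EQ succ j AND a EQ QEx b AND a' EQ QEx b')))))))
def SeqAbstFormP (x i y y' s k : Term) : Form :=
  inst (seqAbstFormBody 0 1 2 3 4 5 6 7 8 9 10 11 12 13 14 15 16 17) [x, i, y, y', s, k]

def abstFormBody (x i y y' s k : ℕ) : Form :=
  VarP x AND OrdP i AND Exs [s, k] (SeqAbstFormP x i y y' s k)
/-- `y'` results from `y` by abstracting the variable `x` to the bound index `i`. -/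
def AbstFormP (x i y y' : Term) : Form := inst (abstFormBody 0 1 2 3 4 5) [x, i, y, y']

/-! ### Codes of formulas -/

def atomicBody (y t u : ℕ) : Form :=
  Exs [t, u] (TermP t AND TermP u AND (y EQ QEq t u OR y EQ QMem t u))
def AtomicP (y : Term) : Form := inst (atomicBody 0 1 2) [y]

def makeFormBody (y b c x b' : ℕ) : Form :=
  y EQ QDisj b c OR y EQ QNeg b OR Exs [x, b'] (AbstFormP x Zero b b' AND y EQ QEx b')
/-- `y` codes a disjunction, a negation or a quantification of the formulas `b`, `c`. -/
def MakeFormP (y b c : Term) : Form := inst (makeFormBody 0 1 2 3 4) [y, b, c]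

def seqFormBody (y s k l a m n b c : ℕ) : Form :=
  LstSeqP s k y AND
  All2 l (succ k) (Ex a (HPair l a IN s AND
    (AtomicP a OR
      Exs [m, n, b, c] (m IN l AND n IN l AND HPair m b IN s AND HPair n c IN s AND
        MakeFormP a b c))))
def SeqFormP (y s k : Term) : Form := inst (seqFormBody 0 1 2 3 4 5 6 7 8) [y, s, k]

def formBody (y s k : ℕ) : Form := Exs [s, k] (SeqFormP y s k)
/-- `y` is the code of a formula. -/
def FormP (y : Term) : Form := inst (formBody 0 1 2) [y]

/-- `y` is the code of a formula in which the variable `x` is not free: substituting `0` for `x`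
leaves it unchanged. -/
def VarNonOccFormP (x y : Term) : Form := FormP y AND SubstFormP x Zero y y

/-! ### Axioms and provability -/

def booleanAxBody (y a b c : ℕ) : Form :=
  Exs [a, b, c] (FormP a AND FormP b AND FormP c AND
    (y EQ QImp a a OR
      y EQ QImp a (QDisj a b) OR
      y EQ QImp (QDisj a a) a OR
      y EQ QImp (QDisj a (QDisj b c)) (QDisj (QDisj a b) c) OR
      y EQ QImp (QDisj c a) (QImp (QDisj (QNeg c) b) (QDisj a b))))
def BooleanAxP (y : Term) : Form := inst (booleanAxBody 0 1 2 3) [y]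

def EqualityAxP (y : Term) : Form :=
  y EQ reflAx.quot OR y EQ eqCongAx.quot OR y EQ memCongAx.quot OR y EQ eatsCongAx.quot

def HFAxP (y : Term) : Form := y EQ hf1.quot OR y EQ hf2.quot

def specialAxBody (y x t a b c : ℕ) : Form :=
  Exs [x, t, a, b, c] (FormP a AND SubstFormP x t a b AND AbstFormP x Zero a c AND
    y EQ QImp b (QEx c))
def SpecialAxP (y : Term) : Form := inst (specialAxBody 0 1 2 3 4 5) [y]

def inductionAxBody (y x w a a0 aw axw b c ca : ℕ) : Form :=
  Exs [x, w, a, a0, aw, axw, b, c, ca] (OrdNeP x w AND VarNonOccFormP w a AND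
    SubstFormP x Zero a a0 AND SubstFormP x w a aw AND SubstFormP x (QEats x w) a axw AND
    AbstFormP w Zero (QImp a (QImp aw axw)) b AND AbstFormP x Zero (QAll b) c AND
    AbstFormP x Zero a ca AND
    y EQ QImp a0 (QImp (QAll c) (QAll ca)))
def InductionAxP (y : Term) : Form := inst (inductionAxBody 0 1 2 3 4 5 6 7 8 9) [y]

def AxiomP (extra : Form) (y : Term) : Form :=
  y EQ extra.quot OR BooleanAxP y OR EqualityAxP y OR HFAxP y OR SpecialAxP y OR InductionAxP y

/-- `z` follows from `x` and `y` by modus ponens. -/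
def ModPonP (x y z : Term) : Form := x EQ QImp y z

def existsBody (p q a a' b x : ℕ) : Form :=
  Exs [a, a', b, x] (FormP a AND VarNonOccFormP x b AND AbstFormP x Zero a a' AND
    p EQ QImp a b AND q EQ QImp (QEx a') b)
/-- `q` follows from `p` by the existential rule. -/
def ExistsP (p q : Term) : Form := inst (existsBody 0 1 2 3 4 5) [p, q]

def substRuleBody (p q x t : ℕ) : Form := Exs [x, t] (SubstFormP x t p q)
/-- `q` follows from `p` by the substitution rule. -/
def SubstRuleP (p q : Term) : Form := inst (substRuleBody 0 1 2 3) [p, q]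

def prfBody (extra : Form) (y s k l a m n b c : ℕ) : Form :=
  LstSeqP s k y AND
  All2 l (succ k) (Ex a (HPair l a IN s AND
    (AxiomP extra a OR
      Exs [m, n, b, c] (m IN l AND n IN l AND HPair m b IN s AND HPair n c IN s AND
        (ModPonP b c a OR ExistsP b a OR SubstRuleP b a)))))
/-- `s` is a proof of `y` in the calculus (from no hypotheses), with last line at `k`. -/
def PrfP (extra : Form) (y s k : Term) : Form :=
  inst (prfBody extra 0 1 2 3 4 5 6 7 8) [y, s, k]

def pfBody (extra : Form) (y s k : ℕ) : Form := Exs [s, k] (PrfP extra y s k)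
/-- The provability predicate. -/
def PfP (extra : Form) (y : Term) : Form := inst (pfBody extra 0 1 2) [y]

end HFCalc

namespace HFCalc

/-! ## Substitution -/

theorem Tm.lift_zero (t : Term) : t.lift 0 = t := by
  match t with
  | .zero => rfl
  | .var _ => rfl
  | .bnd k => exact k.elim0
  | .eats t u => simp [Tm.lift, Tm.lift_zero t, Tm.lift_zero u]

theorem Tm.subst_lift (σ : ℕ → Term) (n : ℕ) (t : Term) :
    (t.lift n).subst σ = (t.subst σ).lift n := by
  match t with
  | .zero => rfl
  | .var i => simp [Tm.lift, Tm.subst, Tm.lift_zero]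
  | .bnd k => exact k.elim0
  | .eats t u => simp [Tm.lift, Tm.subst, Tm.subst_lift σ n t, Tm.subst_lift σ n u]

theorem Tm.subst_subst (σ τ : ℕ → Term) {n : ℕ} (t : Tm n) :
    (t.subst σ).subst τ = t.subst (fun i => (σ i).subst τ) := by
  induction t with
  | zero => rfl
  | var i => simp [Tm.subst, Tm.subst_lift]
  | bnd k => rfl
  | eats t u ht hu => simp [Tm.subst, ht, hu]

theorem Fm.subst_subst (σ τ : ℕ → Term) {n : ℕ} (A : Fm n) :
    (A.subst σ).subst τ = A.subst (fun i => (σ i).subst τ) := by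
  induction A with
  | mem t u => simp [Fm.subst, Tm.subst_subst]
  | eq t u => simp [Fm.subst, Tm.subst_subst]
  | disj A B hA hB => simp [Fm.subst, hA, hB]
  | neg A hA => simp [Fm.subst, hA]
  | ex A hA => simp [Fm.subst, hA]

theorem Tm.subst_congr {σ τ : ℕ → Term} {n : ℕ} {t : Tm n} (h : ∀ i ∈ t.fv, σ i = τ i) :
    t.subst σ = t.subst τ := by
  induction t with
  | zero => rfl
  | var i => simp [Tm.subst, h i (by simp [Tm.fv])]
  | bnd k => rfl
  | eats t u ht hu =>
    simp only [Tm.fv, Finset.mem_union] at h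
    simp [Tm.subst, ht fun i hi => h i (.inl hi), hu fun i hi => h i (.inr hi)]

theorem Fm.subst_congr {σ τ : ℕ → Term} {n : ℕ} {A : Fm n} (h : ∀ i ∈ A.fv, σ i = τ i) :
    A.subst σ = A.subst τ := by
  induction A with
  | mem t u | eq t u =>
    simp only [Fm.fv, Finset.mem_union] at h
    simp [Fm.subst, Tm.subst_congr fun i hi => h i (.inl hi),
      Tm.subst_congr fun i hi => h i (.inr hi)]
  | disj A B hA hB =>
    simp only [Fm.fv, Finset.mem_union] at h
    simp [Fm.subst, hA fun i hi => h i (.inl hi), hB fun i hi => h i (.inr hi)]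
  | neg A hA => simp [Fm.subst, hA h]
  | ex A hA => simp [Fm.subst, hA h]

theorem Tm.subst_var {n : ℕ} (t : Tm n) : t.subst Tm.var = t := by
  induction t with
  | zero => rfl
  | var i => rfl
  | bnd k => rfl
  | eats t u ht hu => simp [Tm.subst, ht, hu]

theorem Fm.subst_var {n : ℕ} (A : Fm n) : A.subst Tm.var = A := by
  induction A with
  | mem t u => simp [Fm.subst, Tm.subst_var]
  | eq t u => simp [Fm.subst, Tm.subst_var]
  | disj A B hA hB => simp [Fm.subst, hA, hB]
  | neg A hA => simp [Fm.subst, hA]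
  | ex A hA => simp [Fm.subst, hA]

/-! ## Instantiation of the outermost bound index -/

def Tm.opn {n : ℕ} (s : Tm (n + 1)) (u : Term) : Tm n :=
  match s with
  | .zero => .zero
  | .var j => .var j
  | .bnd k => Fin.lastCases (u.lift n) (fun k => .bnd k) k
  | .eats t t' => .eats (t.opn u) (t'.opn u)

def Fm.opnAux (u : Term) : {m : ℕ} → Fm m → (n : ℕ) → m = n + 1 → Fm n
  | _, .mem t t', n, h => .mem ((h ▸ t : Tm (n + 1)).opn u) ((h ▸ t' : Tm (n + 1)).opn u)
  | _, .eq t t', n, h => .eq ((h ▸ t : Tm (n + 1)).opn u) ((h ▸ t' : Tm (n + 1)).opn u)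
  | _, .disj A B, n, h => .disj (A.opnAux u n h) (B.opnAux u n h)
  | _, .neg A, n, h => .neg (A.opnAux u n h)
  | _, .ex A, n, h => .ex (A.opnAux u (n + 1) (congrArg (· + 1) h))

/-- Replace the outermost bound index by the term `u`. -/
def Fm.opn {n : ℕ} (A : Fm (n + 1)) (u : Term) : Fm n := A.opnAux u n rfl

@[simp] theorem Fm.opn_mem (u : Term) {n : ℕ} (t t' : Tm (n + 1)) :
    (Fm.mem t t').opn u = .mem (t.opn u) (t'.opn u) := rfl
@[simp] theorem Fm.opn_eq (u : Term) {n : ℕ} (t t' : Tm (n + 1)) :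
    (Fm.eq t t').opn u = .eq (t.opn u) (t'.opn u) := rfl
@[simp] theorem Fm.opn_disj (u : Term) {n : ℕ} (A B : Fm (n + 1)) :
    (Fm.disj A B).opn u = .disj (A.opn u) (B.opn u) := rfl
@[simp] theorem Fm.opn_neg (u : Term) {n : ℕ} (A : Fm (n + 1)) :
    (Fm.neg A).opn u = .neg (A.opn u) := rfl
@[simp] theorem Fm.opn_ex (u : Term) {n : ℕ} (A : Fm (n + 2)) :
    (Fm.ex A).opn u = .ex (A.opn u) := rfl

/-- Induction over the formulas with at least one bound index. -/
theorem Fm.succ_induction {P : {n : ℕ} → Fm (n + 1) → Prop}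
    (mem : ∀ {n} (t u : Tm (n + 1)), P (.mem t u)) (eq : ∀ {n} (t u : Tm (n + 1)), P (.eq t u))
    (disj : ∀ {n} (A B : Fm (n + 1)), P A → P B → P (.disj A B))
    (neg : ∀ {n} (A : Fm (n + 1)), P A → P (.neg A))
    (ex : ∀ {n} (A : Fm (n + 2)), P A → P (.ex A)) {n : ℕ} (A : Fm (n + 1)) : P A := by
  suffices h : ∀ {m} (A : Fm m) (n : ℕ) (hm : m = n + 1), P (hm ▸ A) from h A n rfl
  intro m A
  induction A with
  | mem t u => rintro n rfl; exact mem t u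
  | eq t u => rintro n rfl; exact eq t u
  | disj A B hA hB => rintro n rfl; exact disj A B (hA n rfl) (hB n rfl)
  | neg A hA => rintro n rfl; exact neg A (hA n rfl)
  | ex A hA => rintro n rfl; exact ex A (hA (n + 1) rfl)

theorem Tm.opn_abst (i : ℕ) (u : Term) {n : ℕ} (t : Tm n) :
    (t.abst i).opn u = t.subst (Function.update Tm.var i u) := by
  induction t with
  | zero => rfl
  | var j =>
    by_cases h : j = i
    · subst h; simp [Tm.abst, Tm.opn, Tm.subst]
    · simp [Tm.abst, Tm.opn, Tm.subst, h, Tm.lift]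
  | bnd k => simp [Tm.abst, Tm.opn, Tm.subst]
  | eats t u ht hu => simp [Tm.abst, Tm.opn, Tm.subst, ht, hu]

theorem Fm.opn_abst (i : ℕ) (u : Term) {n : ℕ} (A : Fm n) :
    (A.abst i).opn u = A.subst (Function.update Tm.var i u) := by
  induction A with
  | mem t u => simp [Fm.abst, Fm.subst, Tm.opn_abst]
  | eq t u => simp [Fm.abst, Fm.subst, Tm.opn_abst]
  | disj A B hA hB => simp [Fm.abst, Fm.subst, hA, hB]
  | neg A hA => simp [Fm.abst, Fm.subst, hA]
  | ex A hA => simp [Fm.abst, Fm.subst, hA]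

theorem Tm.abst_opn {i n : ℕ} {t : Tm (n + 1)} (h : i ∉ t.fv) : (t.opn (v i)).abst i = t := by
  match t with
  | .zero => rfl
  | .var j =>
    have : j ≠ i := fun e => h (by simp [Tm.fv, e])
    simp [Tm.abst, Tm.opn, this]
  | .bnd k => cases k using Fin.lastCases <;> simp [Tm.abst, Tm.opn, Tm.lift]
  | .eats t u =>
    simp only [Tm.fv, Finset.mem_union, not_or] at h
    simp [Tm.abst, Tm.opn, Tm.abst_opn h.1, Tm.abst_opn h.2]

theorem Fm.abst_opn {i n : ℕ} {A : Fm (n + 1)} (h : i ∉ A.fv) : (A.opn (v i)).abst i = A := by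
  revert h
  induction A using Fm.succ_induction with
  | mem t u | eq t u =>
    intro h
    simp only [Fm.fv, Finset.mem_union, not_or] at h
    simp [Fm.abst, Tm.abst_opn h.1, Tm.abst_opn h.2]
  | disj A B hA hB =>
    intro h
    simp only [Fm.fv, Finset.mem_union, not_or] at h
    simp [Fm.abst, hA h.1, hB h.2]
  | neg A hA => intro h; simp [Fm.abst, hA h]
  | ex A hA => intro h; simp [Fm.abst, hA h]

theorem Fm.exists_abst (A : Fm 1) : ∃ i B, i ∉ A.fv ∧ B = A.opn (v i) ∧ B.abst i = A := by
  obtain ⟨i, hi⟩ := Infinite.exists_notMem_finset A.fv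
  exact ⟨i, _, hi, rfl, Fm.abst_opn hi⟩

def Fm.size : {n : ℕ} → Fm n → ℕ
  | _, .mem _ _ => 0
  | _, .eq _ _ => 0
  | _, .disj A B => A.size + B.size + 1
  | _, .neg A => A.size + 1
  | _, .ex A => A.size + 1

theorem Fm.size_opn (u : Term) {n : ℕ} (A : Fm (n + 1)) : (A.opn u).size = A.size := by
  induction A using Fm.succ_induction with
  | mem t u => rfl
  | eq t u => rfl
  | disj A B hA hB => simp [Fm.size, hA, hB]
  | neg A hA => simp [Fm.size, hA]
  | ex A hA => simp [Fm.size, hA]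

/-- Induction over formulas in which a quantified formula is obtained by abstraction. -/
theorem Form.induction {P : Form → Prop} (mem : ∀ t u, P (.mem t u)) (eq : ∀ t u, P (.eq t u))
    (disj : ∀ A B, P A → P B → P (.disj A B)) (neg : ∀ A, P A → P (.neg A))
    (ex : ∀ A : Fm 1, (∀ u, P (A.opn u)) → P (.ex A)) (A : Form) : P A := by
  induction h : A.size using Nat.strong_induction_on generalizing A with
  | _ N ih =>
    subst h
    match A with
    | .mem t u => exact mem t u
    | .eq t u => exact eq t u
    | .disj A B =>
      exact disj A B (ih _ (by simp only [Fm.size]; omega) A rfl)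
        (ih _ (by simp only [Fm.size]; omega) B rfl)
    | .neg A => exact neg A (ih _ (by simp [Fm.size]) A rfl)
    | .ex A => exact ex A fun u => ih _ (by simp [Fm.size]) _ (A.size_opn u)

/-! ## Structures -/

class HFStr (M : Type) where
  zero : M
  eats : M → M → M
  mem : M → M → Prop

section Semantics

variable {M : Type} [HFStr M]

def Tm.eval (ρ : ℕ → M) {n : ℕ} (b : Fin n → M) : Tm n → M
  | .zero => HFStr.zero
  | .var i => ρ i
  | .bnd k => b k
  | .eats t u => HFStr.eats (t.eval ρ b) (u.eval ρ b)

def Fm.Sat (ρ : ℕ → M) : {n : ℕ} → (Fin n → M) → Fm n → Prop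
  | _, b, .mem t u => HFStr.mem (t.eval ρ b) (u.eval ρ b)
  | _, b, .eq t u => t.eval ρ b = u.eval ρ b
  | _, b, .disj A B => A.Sat ρ b ∨ B.Sat ρ b
  | _, b, .neg A => ¬ A.Sat ρ b
  | _, b, .ex A => ∃ a, A.Sat ρ (Fin.cons a b : Fin _ → M)

/-- The value of a term of the calculus. -/
def Tm.val (ρ : ℕ → M) (t : Term) : M := t.eval ρ Fin.elim0

/-- Truth of a formula of the calculus. -/
def Holds (ρ : ℕ → M) (A : Form) : Prop := A.Sat ρ Fin.elim0

theorem Tm.eval_lift (ρ : ℕ → M) {n : ℕ} (b : Fin n → M) (t : Term) :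
    (t.lift n).eval ρ b = t.val ρ := by
  match t with
  | .zero => rfl
  | .var _ => rfl
  | .bnd k => exact k.elim0
  | .eats t u =>
    have h1 := Tm.eval_lift ρ b t
    have h2 := Tm.eval_lift ρ b u
    simp only [Tm.val] at *
    simp [Tm.lift, Tm.eval, h1, h2]

theorem Tm.eval_subst (ρ : ℕ → M) (σ : ℕ → Term) {n : ℕ} (b : Fin n → M) (t : Tm n) :
    (t.subst σ).eval ρ b = t.eval (fun i => (σ i).val ρ) b := by
  induction t with
  | zero => rfl
  | var i => simp [Tm.subst, Tm.eval, Tm.eval_lift]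
  | bnd k => rfl
  | eats t u ht hu => simp [Tm.subst, Tm.eval, ht, hu]

theorem Fm.sat_subst (ρ : ℕ → M) (σ : ℕ → Term) {n : ℕ} (b : Fin n → M) (A : Fm n) :
    (A.subst σ).Sat ρ b ↔ A.Sat (fun i => (σ i).val ρ) b := by
  induction A with
  | mem t u => simp [Fm.subst, Fm.Sat, Tm.eval_subst]
  | eq t u => simp [Fm.subst, Fm.Sat, Tm.eval_subst]
  | disj A B hA hB => simp [Fm.subst, Fm.Sat, hA, hB]
  | neg A hA => simp [Fm.subst, Fm.Sat, hA]
  | ex A hA => simp [Fm.subst, Fm.Sat, hA]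

theorem Tm.eval_abst (ρ : ℕ → M) (i : ℕ) (a : M) {n : ℕ} (b : Fin n → M) (t : Tm n) :
    (t.abst i).eval ρ (Fin.snoc b a : Fin (n + 1) → M) = t.eval (Function.update ρ i a) b := by
  induction t with
  | zero => rfl
  | var j => by_cases h : j = i <;> simp [Tm.abst, Tm.eval, h]
  | bnd k => simp [Tm.abst, Tm.eval]
  | eats t u ht hu => simp [Tm.abst, Tm.eval, ht, hu]

theorem Fm.sat_abst (ρ : ℕ → M) (i : ℕ) (a : M) {n : ℕ} (b : Fin n → M) (A : Fm n) :
    (A.abst i).Sat ρ (Fin.snoc b a : Fin (n + 1) → M) ↔ A.Sat (Function.update ρ i a) b := by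
  induction A with
  | mem t u => simp [Fm.abst, Fm.Sat, Tm.eval_abst]
  | eq t u => simp [Fm.abst, Fm.Sat, Tm.eval_abst]
  | disj A B hA hB => simp [Fm.abst, Fm.Sat, hA, hB]
  | neg A hA => simp [Fm.abst, Fm.Sat, hA]
  | ex A hA => simp [Fm.abst, Fm.Sat, Fin.cons_snoc_eq_snoc_cons, hA]

theorem Tm.eval_opn (ρ : ℕ → M) (u : Term) {n : ℕ} (b : Fin n → M) (t : Tm (n + 1)) :
    (t.opn u).eval ρ b = t.eval ρ (Fin.snoc b (u.val ρ) : Fin (n + 1) → M) := by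
  match t with
  | .zero => rfl
  | .var j => rfl
  | .bnd k => cases k using Fin.lastCases <;> simp [Tm.opn, Tm.eval, Tm.eval_lift]
  | .eats t t' => simp [Tm.opn, Tm.eval, Tm.eval_opn ρ u b t, Tm.eval_opn ρ u b t']

theorem Fm.sat_opn (ρ : ℕ → M) (u : Term) {n : ℕ} (b : Fin n → M) (A : Fm (n + 1)) :
    (A.opn u).Sat ρ b ↔ A.Sat ρ (Fin.snoc b (u.val ρ) : Fin (n + 1) → M) := by
  induction A using Fm.succ_induction with
  | mem t u => simp [Fm.Sat, Tm.eval_opn]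
  | eq t u => simp [Fm.Sat, Tm.eval_opn]
  | disj A B hA hB => simp [Fm.Sat, hA, hB]
  | neg A hA => simp [Fm.Sat, hA]
  | ex A hA => simp [Fm.Sat, Fin.cons_snoc_eq_snoc_cons, hA]

theorem cons_elim0_eq_snoc {M : Type} (a : M) :
    (Fin.cons a Fin.elim0 : Fin 1 → M) = Fin.snoc (Fin.elim0 : Fin 0 → M) a := by
  ext i; fin_cases i; rfl

@[simp] theorem val_zero (ρ : ℕ → M) : Tm.val ρ .zero = HFStr.zero := rfl
@[simp] theorem val_var (ρ : ℕ → M) (i : ℕ) : Tm.val ρ (.var i) = ρ i := rfl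
@[simp] theorem val_eats (ρ : ℕ → M) (t u : Term) :
    Tm.val ρ (.eats t u) = HFStr.eats (t.val ρ) (u.val ρ) := rfl

@[simp] theorem holds_mem (ρ : ℕ → M) (t u : Term) :
    Holds ρ (.mem t u) ↔ HFStr.mem (t.val ρ) (u.val ρ) := .rfl
@[simp] theorem holds_eq (ρ : ℕ → M) (t u : Term) :
    Holds ρ (.eq t u) ↔ t.val ρ = u.val ρ := .rfl
@[simp] theorem holds_disj (ρ : ℕ → M) (A B : Form) :
    Holds ρ (.disj A B) ↔ Holds ρ A ∨ Holds ρ B := .rfl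
@[simp] theorem holds_neg (ρ : ℕ → M) (A : Form) : Holds ρ (.neg A) ↔ ¬ Holds ρ A := .rfl
@[simp] theorem holds_conj (ρ : ℕ → M) (A B : Form) :
    Holds ρ (Conj A B) ↔ Holds ρ A ∧ Holds ρ B := by
  simp [Conj]
@[simp] theorem holds_imp (ρ : ℕ → M) (A B : Form) :
    Holds ρ (Imp A B) ↔ (Holds ρ A → Holds ρ B) := by
  simp [Imp, imp_iff_not_or]
@[simp] theorem holds_biimp (ρ : ℕ → M) (A B : Form) :
    Holds ρ (Biimp A B) ↔ (Holds ρ A ↔ Holds ρ B) := by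
  simp [Biimp, iff_def]

theorem holds_ex_iff (ρ : ℕ → M) (A : Fm 1) :
    Holds ρ (.ex A) ↔ ∃ a, A.Sat ρ (Fin.snoc Fin.elim0 a : Fin 1 → M) := by
  simp only [Holds, Fm.Sat, cons_elim0_eq_snoc]

theorem holds_opn (ρ : ℕ → M) (u : Term) (A : Fm 1) :
    Holds ρ (A.opn u) ↔ A.Sat ρ (Fin.snoc Fin.elim0 (u.val ρ) : Fin 1 → M) := Fm.sat_opn ..

@[simp] theorem holds_Ex (ρ : ℕ → M) (i : ℕ) (A : Form) :
    Holds ρ (Ex i A) ↔ ∃ a, Holds (Function.update ρ i a) A := by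
  rw [Ex, holds_ex_iff]
  exact exists_congr fun a => Fm.sat_abst ..

@[simp] theorem holds_All (ρ : ℕ → M) (i : ℕ) (A : Form) :
    Holds ρ (All i A) ↔ ∀ a, Holds (Function.update ρ i a) A := by
  simp [All]

@[simp] theorem holds_subst (ρ : ℕ → M) (σ : ℕ → Term) (A : Form) :
    Holds ρ (A.subst σ) ↔ Holds (fun i => (σ i).val ρ) A := Fm.sat_subst ..

@[simp] theorem holds_sub (ρ : ℕ → M) (A : Form) (i : ℕ) (x : Term) :
    Holds ρ (A.sub i x) ↔ Holds (Function.update ρ i (x.val ρ)) A := by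
  rw [Fm.sub, holds_subst]
  have : (fun j => (Function.update Tm.var i x j).val ρ) = Function.update ρ i (x.val ρ) := by
    ext j
    by_cases h : j = i
    · subst h; simp
    · simp [h]
  rw [this]

theorem holds_inst (ρ : ℕ → M) (A : Form) (l : List Term) :
    Holds ρ (inst A l) ↔ Holds (fun i => (l.getD i (v i)).val ρ) A := holds_subst ..

theorem Tm.eval_congr {ρ ρ' : ℕ → M} {n : ℕ} {t : Tm n} (h : ∀ i ∈ t.fv, ρ i = ρ' i)
    (b : Fin n → M) : t.eval ρ b = t.eval ρ' b := by
  induction t with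
  | zero => rfl
  | var i => exact h i (by simp [Tm.fv])
  | bnd k => rfl
  | eats t u ht hu =>
    simp only [Tm.fv, Finset.mem_union] at h
    simp [Tm.eval, ht fun i hi => h i (.inl hi), hu fun i hi => h i (.inr hi)]

theorem Fm.sat_congr {ρ ρ' : ℕ → M} {n : ℕ} {A : Fm n} (h : ∀ i ∈ A.fv, ρ i = ρ' i)
    (b : Fin n → M) : A.Sat ρ b ↔ A.Sat ρ' b := by
  induction A with
  | mem t u | eq t u =>
    simp only [Fm.fv, Finset.mem_union] at h
    simp [Fm.Sat, Tm.eval_congr fun i hi => h i (.inl hi),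
      Tm.eval_congr fun i hi => h i (.inr hi)]
  | disj A B hA hB =>
    simp only [Fm.fv, Finset.mem_union] at h
    simp [Fm.Sat, hA fun i hi => h i (.inl hi), hB fun i hi => h i (.inr hi)]
  | neg A hA => simp [Fm.Sat, hA h]
  | ex A hA => simp [Fm.Sat, hA h]

theorem holds_congr {ρ ρ' : ℕ → M} {A : Form} (h : ∀ i ∈ A.fv, ρ i = ρ' i) :
    Holds ρ A ↔ Holds ρ' A := Fm.sat_congr h _

end Semantics

/-! ## Propositional reasoning -/

/-- Provability without hypotheses. -/
abbrev Pr (extra A : Form) : Prop := Thm extra ∅ A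

section Propositional

variable {extra A B C D : Form}

theorem Pr.mp (h : Pr extra (A IMP B)) (h' : Pr extra A) : Pr extra B := by
  simpa using Thm.mp h h'

theorem Thm.weaken {H : Set Form} (h : Pr extra A) : Thm extra H A := by
  simpa using Thm.mp (H := H) (.bool (.ident A)) h

theorem Pr.left (h : Pr extra A) : Pr extra (A OR B) := .mp (.bool (.disjI A B)) h

theorem Pr.contr (h : Pr extra (A OR A)) : Pr extra A := .mp (.bool (.disjCont A)) h

theorem Pr.cut (h : Pr extra (C OR A)) (h' : Pr extra (Neg C OR B)) : Pr extra (A OR B) :=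
  .mp (.mp (.bool (.disjConj A B C)) h) h'

theorem Pr.comm (h : Pr extra (A OR B)) : Pr extra (B OR A) := .cut h (.bool (.ident A))

theorem Pr.right (h : Pr extra B) : Pr extra (A OR B) := h.left.comm

theorem Pr.assoc (h : Pr extra (A OR (B OR C))) : Pr extra ((A OR B) OR C) :=
  .mp (.bool (.disjAssoc A B C)) h

theorem Pr.assoc' (h : Pr extra ((A OR B) OR C)) : Pr extra (A OR (B OR C)) :=
  h.comm.assoc.comm.assoc.comm

theorem Pr.ident : Pr extra (A IMP A) := .bool (.ident A)

theorem Pr.em : Pr extra (A OR Neg A) := Pr.comm .ident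

theorem Pr.dni (h : Pr extra (A OR B)) : Pr extra (Neg (Neg A) OR B) :=
  (Pr.cut h Pr.em).comm

theorem Pr.dne (h : Pr extra (Neg (Neg A) OR B)) : Pr extra (A OR B) :=
  .cut .ident h

theorem Pr.dne₀ (h : Pr extra (Neg (Neg A))) : Pr extra A := .contr (.comm (.dne h.left))

theorem Pr.trans (h : Pr extra (A IMP B)) (h' : Pr extra (B IMP C)) : Pr extra (A IMP C) :=
  .cut h.comm h'

theorem Pr.const (h : Pr extra B) : Pr extra (A IMP B) := h.right

theorem Pr.app (h : Pr extra (C IMP (A IMP B))) (h' : Pr extra (C IMP A)) :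
    Pr extra (C IMP B) := by
  have h1 : Pr extra (Neg A OR (B OR Neg C)) := (Pr.comm h).assoc'
  have h2 : Pr extra (Neg C OR (B OR Neg C)) := .cut (Pr.comm h') h1
  have h3 : Pr extra ((Neg C OR Neg C) OR B) := h2.comm.assoc'.comm
  exact .comm (.cut h3 (.bool (.disjCont (Neg C))))

theorem Pr.fst : Pr extra ((A AND B) IMP A) := by
  have h : Pr extra (Neg B OR (A OR Neg A)) := .right .em
  exact .dni h.assoc.comm.assoc

theorem Pr.snd : Pr extra ((A AND B) IMP B) := by
  have h : Pr extra (Neg A OR (Neg B OR B)) := .right .ident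
  exact .dni h.assoc

theorem Pr.imp_neg_of_not_and (h : Pr extra (Neg (C AND A))) : Pr extra (C IMP Neg A) :=
  .dne₀ h

theorem Pr.neg_of_imp_neg (h : Pr extra (C IMP A)) (h' : Pr extra (C IMP Neg A)) :
    Pr extra (Neg C) := .contr (.cut (Pr.comm h) (Pr.comm h'))

theorem Pr.imp_disj_left (h : Pr extra (C IMP A)) : Pr extra (C IMP (A OR B)) :=
  .trans h (.bool (.disjI A B))

theorem Pr.imp_disj_right (h : Pr extra (C IMP B)) : Pr extra (C IMP (A OR B)) := by
  have h1 : Pr extra (A OR (B OR Neg B)) := .right .em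
  exact .trans h h1.assoc.comm

theorem Pr.neg_imp_of_disj : Pr extra ((A OR B) IMP (Neg A IMP B)) := by
  have h : Pr extra ((A OR B) OR Neg (A OR B)) := .em
  have h1 : Pr extra (Neg (Neg A) OR (B OR Neg (A OR B))) := .dni h.assoc'
  exact h1.assoc.comm

end Propositional

/-! ## Simultaneous substitution -/

theorem Term.subst_var_eq (k : ℕ) (σ : ℕ → Term) : (v k).subst σ = σ k := Tm.lift_zero _

theorem Pr.subst_list {extra : Form} (σ : ℕ → Term) (L : List ℕ) (hL : L.Nodup)
    (h : ∀ j ∈ L, ∀ i ∈ L, i ∉ (σ j).fv) {A : Form} (hA : Pr extra A) :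
    Pr extra (A.subst fun i => if i ∈ L then σ i else v i) := by
  induction L with
  | nil => simpa [Fm.subst_var] using hA
  | cons i L ih =>
    have hi : i ∉ L := (List.nodup_cons.1 hL).1
    have h1 := ih (List.nodup_cons.1 hL).2
      fun j hj k hk => h j (List.mem_cons_of_mem _ hj) k (List.mem_cons_of_mem _ hk)
    have h2 := Thm.subst (i := i) (x := σ i) h1 (by simp)
    rw [Fm.sub, Fm.subst_subst] at h2
    convert h2 using 2
    ext j
    by_cases hj : j = i
    · subst hj; simp [hi, Term.subst_var_eq]
    · by_cases hjL : j ∈ L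
      · have : (σ j).subst (Function.update Tm.var i (σ i)) = (σ j).subst Tm.var :=
          Tm.subst_congr fun k hk => Function.update_of_ne
            (by rintro rfl; exact h j (List.mem_cons_of_mem _ hjL) _ List.mem_cons_self hk) _ _
        simp [hjL, this, Tm.subst_var]
      · simp [hj, hjL, Term.subst_var_eq]

/-- The calculus is closed under simultaneous substitution. -/
theorem Pr.subst {extra : Form} (σ : ℕ → Term) {A : Form} (hA : Pr extra A) :
    Pr extra (A.subst σ) := by
  obtain ⟨N, hN⟩ : ∃ N, ∀ i ∈ A.fv ∪ A.fv.biUnion fun j => (σ j).fv, i < N :=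
    ⟨_, fun i hi => Nat.lt_succ_of_le (Finset.le_sup (f := id) hi)⟩
  simp only [Finset.mem_union, Finset.mem_biUnion] at hN
  have h1 := Pr.subst_list (fun j => v (N + j)) A.fv.toList A.fv.nodup_toList
    (fun j hj i hi => by
      have := hN i (.inl (by simpa using hi))
      simp [Tm.fv]; omega) hA
  have h2 := Pr.subst_list (fun j => σ (j - N)) (A.fv.toList.map (N + ·))
    (A.fv.nodup_toList.map fun _ _ => by simp)
    (fun j hj i hi hij => by
      simp only [List.mem_map, Finset.mem_toList] at hi hj
      obtain ⟨i, hi, rfl⟩ := hi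
      obtain ⟨j, hj, rfl⟩ := hj
      have := hN (N + i) (.inr ⟨j, hj, by simpa using hij⟩)
      omega) h1
  rw [Fm.subst_subst] at h2
  convert h2 using 1
  refine Fm.subst_congr fun i hi => ?_
  simp [hi, Term.subst_var_eq]

/-! ## Quantifier rules for formulas with a bound index -/

theorem Pr.opn_imp_ex {extra : Form} (A : Fm 1) (u : Term) : Pr extra (A.opn u IMP Fm.ex A) := by
  obtain ⟨i, B, -, -, rfl⟩ := A.exists_abst
  have h := Thm.spec (extra := extra) (H := ∅) (.spec B i u)
  rwa [Fm.sub, ← Fm.opn_abst] at h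

theorem Pr.ex_imp {extra : Form} {A : Fm 1} {B : Form} {i : ℕ} (hA : i ∉ A.fv) (hB : i ∉ B.fv)
    (h : Pr extra (A.opn (v i) IMP B)) : Pr extra (Fm.ex A IMP B) := by
  have := Thm.exist h hB (by simp)
  rwa [Ex, Fm.abst_opn hA] at this

/-! ## Complete theories with witnesses -/

/-- `T` is a complete theory, containing all theorems, in which existential formulas have variables
as witnesses. -/
structure Henkin (extra : Form) (T : Set Form) : Prop where
  thm : ∀ {A}, Pr extra A → A ∈ T
  mp : ∀ {A B}, (A IMP B) ∈ T → A ∈ T → B ∈ T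
  neg_iff : ∀ {A}, Neg A ∈ T ↔ A ∉ T
  witness : ∀ {A}, Fm.ex A ∈ T → ∃ i, A.opn (v i) ∈ T

section Lindenbaum

variable {extra : Form}

theorem exists_decide (C φ : Form) (hC : ¬ Pr extra (Neg C)) :
    ∃ C', ¬ Pr extra (Neg C') ∧ Pr extra (C' IMP C) ∧
      (Pr extra (C' IMP φ) ∨ Pr extra (C' IMP Neg φ)) ∧
      ∀ A, φ = Fm.ex A → Pr extra (C' IMP φ) → ∃ i, Pr extra (C' IMP A.opn (v i)) := by
  by_cases h : Pr extra (Neg (C AND φ))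
  · have h' := Pr.imp_neg_of_not_and h
    exact ⟨C, hC, .ident, .inr h', fun _ _ h2 => absurd (Pr.neg_of_imp_neg h2 h') hC⟩
  by_cases hφ : ∃ A, φ = Fm.ex A
  · obtain ⟨A, rfl⟩ := hφ
    obtain ⟨i, hi⟩ := Infinite.exists_notMem_finset ((C AND Fm.ex A).fv ∪ A.fv)
    simp only [Finset.mem_union, not_or] at hi
    refine ⟨(C AND Fm.ex A) AND A.opn (v i), fun h1 => h ?_, .trans .fst .fst,
      .inl (.trans .fst .snd), fun B hB _ => ?_⟩
    · have h2 : Pr extra (A.opn (v i) IMP Neg (C AND Fm.ex A)) :=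
        Pr.comm (Pr.imp_neg_of_not_and h1)
      exact .neg_of_imp_neg .snd (Pr.comm (Pr.ex_imp hi.2 hi.1 h2))
    · cases hB
      exact ⟨i, .snd⟩
  · exact ⟨C AND φ, h, .fst, .inl .snd, fun A hA => absurd ⟨A, hA⟩ hφ⟩

def Tm.enc {n : ℕ} : Tm n → ℕ
  | .zero => Nat.pair 0 0
  | .var i => Nat.pair 1 i
  | .bnd k => Nat.pair 2 k
  | .eats t u => Nat.pair 3 (Nat.pair t.enc u.enc)

theorem Tm.enc_injective {n : ℕ} : Function.Injective (Tm.enc (n := n)) := by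
  intro t
  induction t with
  | zero | var i | bnd k => intro u; cases u <;> simp [Tm.enc, Fin.ext_iff]
  | eats t t' h h' =>
    intro u
    cases u <;> simp [Tm.enc]
    exact fun h1 h2 => ⟨h h1, h' h2⟩

def Fm.enc : {n : ℕ} → Fm n → ℕ
  | _, .mem t u => Nat.pair 0 (Nat.pair t.enc u.enc)
  | _, .eq t u => Nat.pair 1 (Nat.pair t.enc u.enc)
  | _, .disj A B => Nat.pair 2 (Nat.pair A.enc B.enc)
  | _, .neg A => Nat.pair 3 A.enc
  | _, .ex A => Nat.pair 4 A.enc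

theorem Fm.enc_injective {n : ℕ} : Function.Injective (Fm.enc (n := n)) := by
  intro A
  induction A with
  | mem t u | eq t u =>
    intro B
    cases B <;> simp [Fm.enc]
    exact fun h1 h2 => ⟨Tm.enc_injective h1, Tm.enc_injective h2⟩
  | disj A A' h h' =>
    intro B
    cases B <;> simp [Fm.enc]
    exact fun h1 h2 => ⟨h h1, h' h2⟩
  | neg A h | ex A h =>
    intro B
    cases B <;> simp [Fm.enc]
    exact fun h1 => h h1

instance {n : ℕ} : Countable (Tm n) := Tm.enc_injective.countable
instance {n : ℕ} : Countable (Fm n) := Fm.enc_injective.countable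

theorem exists_henkin {C : Form} (hC : ¬ Pr extra (Neg C)) :
    ∃ T, Henkin extra T ∧ C ∈ T := by
  have : Nonempty Form := ⟨C⟩
  obtain ⟨f, hf⟩ := exists_surjective_nat Form
  choose g hg using exists_decide (extra := extra)
  let Γ : ℕ → {C : Form // ¬ Pr extra (Neg C)} := fun n =>
    Nat.rec ⟨C, hC⟩ (fun n D => ⟨g D.1 (f n) D.2, (hg D.1 (f n) D.2).1⟩) n
  have hΓ : ∀ n, Pr extra ((Γ (n + 1)).1 IMP (Γ n).1) := fun n => (hg _ (f n) (Γ n).2).2.1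
  have mono : ∀ m n, m ≤ n → Pr extra ((Γ n).1 IMP (Γ m).1) := by
    intro m n h
    induction n, h using Nat.le_induction with
    | base => exact .ident
    | succ n _ ih => exact .trans (hΓ n) ih
  refine ⟨{A | ∃ n, Pr extra ((Γ n).1 IMP A)}, ⟨?_, ?_, ?_, ?_⟩, 0, .ident⟩
  · exact fun h => ⟨0, h.const⟩
  · rintro A B ⟨m, hm⟩ ⟨n, hn⟩
    exact ⟨max m n, .app (.trans (mono m _ (le_max_left _ _)) hm)
      (.trans (mono n _ (le_max_right _ _)) hn)⟩
  · intro A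
    constructor
    · rintro ⟨m, hm⟩ ⟨n, hn⟩
      exact (Γ (max m n)).2 (.neg_of_imp_neg (.trans (mono n _ (le_max_right _ _)) hn)
        (.trans (mono m _ (le_max_left _ _)) hm))
    · intro h
      obtain ⟨n, rfl⟩ := hf A
      rcases (hg _ (f n) (Γ n).2).2.2.1 with h1 | h1
      · exact absurd ⟨n + 1, h1⟩ h
      · exact ⟨n + 1, h1⟩
  · rintro A ⟨m, hm⟩
    obtain ⟨n, hn⟩ := hf (.ex A)
    have h := hg _ (f n) (Γ n).2
    rcases h.2.2.1 with h1 | h1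
    · obtain ⟨i, hi⟩ := h.2.2.2 A hn h1
      exact ⟨i, n + 1, hi⟩
    · rw [hn] at h1
      exact absurd (Pr.neg_of_imp_neg (.trans (mono m _ (le_max_left m (n + 1))) hm)
        (.trans (mono (n + 1) _ (le_max_right m (n + 1))) (hn ▸ h1))) (Γ (max m (n + 1))).2

end Lindenbaum

namespace Henkin

variable {extra : Form} {T : Set Form} (hT : Henkin extra T) {A B : Form}
include hT

theorem disj_iff : (A OR B) ∈ T ↔ A ∈ T ∨ B ∈ T := by
  constructor
  · intro h
    by_contra! h'
    exact h'.2 (hT.mp (hT.mp (hT.thm .neg_imp_of_disj) h) (hT.neg_iff.2 h'.1))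
  · rintro (h | h)
    · exact hT.mp (hT.thm (.imp_disj_left .ident)) h
    · exact hT.mp (hT.thm (.imp_disj_right .ident)) h

theorem imp_iff : (A IMP B) ∈ T ↔ (A ∈ T → B ∈ T) := by
  rw [Imp, hT.disj_iff, hT.neg_iff, imp_iff_not_or]

theorem conj_iff : (A AND B) ∈ T ↔ A ∈ T ∧ B ∈ T := by
  rw [Conj, hT.neg_iff, hT.disj_iff, hT.neg_iff, hT.neg_iff]
  tauto

theorem ex_iff {A : Fm 1} : Fm.ex A ∈ T ↔ ∃ t, A.opn t ∈ T :=
  ⟨fun h => (hT.witness h).imp' v fun _ => id,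
    fun ⟨t, h⟩ => hT.mp (hT.thm (.opn_imp_ex A t)) h⟩

/-- Instances of the axioms `v₁ = v₂ ∧ v₃ = v₄ → …`. -/
theorem inst_mem (h : Pr extra A) (l : List Term) : inst A l ∈ T := hT.thm (.subst _ h)

theorem refl (t : Term) : (t EQ t) ∈ T := by
  simpa [inst, reflAx, Fm.subst, Tm.subst, Tm.lift_zero] using
    hT.inst_mem (.eq .refl) [t, t]

theorem eq_cong {s t s' t' : Term} (h : (s EQ t) ∈ T) (h' : (s' EQ t') ∈ T)
    (h2 : (s EQ s') ∈ T) : (t EQ t') ∈ T := by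
  have : ((s EQ t AND s' EQ t') IMP (s EQ s' IMP t EQ t')) ∈ T := by
    simpa [inst, eqCongAx, Fm.subst, Tm.subst, Tm.lift_zero, Imp, Conj] using
      hT.inst_mem (.eq .eqCong) [s, s, t, s', t']
  simp only [hT.imp_iff, hT.conj_iff] at this
  exact this ⟨h, h'⟩ h2

theorem mem_cong {s t s' t' : Term} (h : (s EQ t) ∈ T) (h' : (s' EQ t') ∈ T)
    (h2 : (s IN s') ∈ T) : (t IN t') ∈ T := by
  have : ((s EQ t AND s' EQ t') IMP (s IN s' IMP t IN t')) ∈ T := by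
    simpa [inst, memCongAx, Fm.subst, Tm.subst, Tm.lift_zero, Imp, Conj] using
      hT.inst_mem (.eq .memCong) [s, s, t, s', t']
  simp only [hT.imp_iff, hT.conj_iff] at this
  exact this ⟨h, h'⟩ h2

theorem eats_cong {s t s' t' : Term} (h : (s EQ t) ∈ T) (h' : (s' EQ t') ∈ T) :
    (Eats s s' EQ Eats t t') ∈ T := by
  have : ((s EQ t AND s' EQ t') IMP (Eats s s' EQ Eats t t')) ∈ T := by
    simpa [inst, eatsCongAx, Fm.subst, Tm.subst, Tm.lift_zero, Imp, Conj] using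
      hT.inst_mem (.eq .eatsCong) [s, s, t, s', t']
  simp only [hT.imp_iff, hT.conj_iff] at this
  exact this ⟨h, h'⟩

theorem symm {s t : Term} (h : (s EQ t) ∈ T) : (t EQ s) ∈ T :=
  hT.eq_cong h (hT.refl s) (hT.refl s)

theorem trans {s t u : Term} (h : (s EQ t) ∈ T) (h' : (t EQ u) ∈ T) : (s EQ u) ∈ T :=
  hT.eq_cong (hT.refl s) h' h

end Henkin

/-! ## The term model -/

section TermModel

variable {extra : Form} {T : Set Form}

def termSetoid (hT : Henkin extra T) : Setoid Term where
  r s t := (s EQ t) ∈ T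
  iseqv := ⟨hT.refl, hT.symm, hT.trans⟩

abbrev TermModel (hT : Henkin extra T) : Type := Quotient (termSetoid hT)

def TermModel.mk (hT : Henkin extra T) (t : Term) : TermModel hT := Quotient.mk _ t

instance (hT : Henkin extra T) : HFStr (TermModel hT) where
  zero := .mk hT .zero
  eats := Quotient.map₂ Tm.eats fun _ _ h _ _ h' => hT.eats_cong h h'
  mem := Quotient.lift₂ (fun s t => (s IN t) ∈ T) fun _ _ _ _ h h' =>
    propext ⟨hT.mem_cong h h', hT.mem_cong (hT.symm h) (hT.symm h')⟩

theorem TermModel.val_eq (hT : Henkin extra T) (t : Term) :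
    t.val (fun i => TermModel.mk hT (v i)) = .mk hT t := by
  match t with
  | .zero => rfl
  | .var _ => rfl
  | .bnd k => exact k.elim0
  | .eats t u => rw [val_eats, TermModel.val_eq hT t, TermModel.val_eq hT u]; rfl

theorem TermModel.mk_surjective (hT : Henkin extra T) : Function.Surjective (TermModel.mk hT) :=
  Quotient.mk_surjective

theorem TermModel.holds_iff (hT : Henkin extra T) (A : Form) :
    Holds (fun i => TermModel.mk hT (v i)) A ↔ A ∈ T := by
  induction A using Form.induction with
  | mem t u => rw [holds_mem, val_eq, val_eq]; rfl
  | eq t u => rw [holds_eq, val_eq, val_eq]; exact Quotient.eq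
  | disj A B hA hB => rw [holds_disj, hA, hB, hT.disj_iff]
  | neg A hA => rw [holds_neg, hA, hT.neg_iff]
  | ex A hA =>
    rw [holds_ex_iff, (mk_surjective hT).exists, hT.ex_iff]
    refine exists_congr fun t => ?_
    rw [← hA, holds_opn, val_eq]

theorem TermModel.holds_of_pr (hT : Henkin extra T) {A : Form} (h : Pr extra A)
    (ρ : ℕ → TermModel hT) : Holds ρ A := by
  choose σ hσ using fun i => mk_surjective hT (ρ i)
  have := (holds_iff hT (A.subst σ)).2 (hT.thm (.subst σ h))
  simpa [val_eq, hσ] using this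

end TermModel

/-! ## Models of HF and completeness -/

/-- Countable models of the HF axioms. -/
class HFModel (M : Type) extends HFStr M where
  countable : Countable M
  not_mem_zero : ∀ x : M, ¬ mem x zero
  mem_eats_iff : ∀ x y u : M, mem u (eats x y) ↔ mem u x ∨ u = y
  eq_zero : ∀ z : M, (∀ x, ¬ mem x z) → z = zero
  eq_eats : ∀ x y z : M, (∀ u, mem u z ↔ mem u x ∨ u = y) → z = eats x y
  ind : ∀ (A : Form) (ρ : ℕ → M) (i : ℕ), Holds (Function.update ρ i zero) A →
    (∀ x y, Holds (Function.update ρ i x) A → Holds (Function.update ρ i y) A →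
      Holds (Function.update ρ i (eats x y)) A) → ∀ x, Holds (Function.update ρ i x) A

theorem forall_of_hf1 {M : Type} [HFStr M] {ρ : ℕ → M} (h : Holds ρ hf1) :
    ρ 0 = HFStr.zero ↔ ∀ x, ¬ HFStr.mem x (ρ 0) := by
  simpa [hf1] using h

theorem forall_of_hf2 {M : Type} [HFStr M] {ρ : ℕ → M} (h : Holds ρ hf2) :
    ρ 0 = HFStr.eats (ρ 1) (ρ 2) ↔
      ∀ u, (HFStr.mem u (ρ 0) ↔ HFStr.mem u (ρ 1) ∨ u = ρ 2) := by
  simpa [hf2] using h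

instance {extra : Form} {T : Set Form} (hT : Henkin extra T) : HFModel (TermModel hT) where
  countable := (TermModel.mk_surjective hT).countable
  not_mem_zero := by
    have := forall_of_hf1 (TermModel.holds_of_pr hT (.hf .hf1) fun _ => HFStr.zero)
    exact this.1 rfl
  eq_zero z := (forall_of_hf1 (TermModel.holds_of_pr hT (.hf .hf1) fun _ => z)).2
  mem_eats_iff x y := by
    have := forall_of_hf2 (TermModel.holds_of_pr hT (.hf .hf2)
      fun n => if n = 0 then HFStr.eats x y else if n = 1 then x else y)
    exact this.1 rfl
  eq_eats x y z := by
    have := forall_of_hf2 (TermModel.holds_of_pr hT (.hf .hf2)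
      fun n => if n = 0 then z else if n = 1 then x else y)
    exact this.2
  ind A ρ i h0 h1 := by
    obtain ⟨j, hj⟩ := Infinite.exists_notMem_finset (insert i A.fv)
    simp only [Finset.mem_insert, not_or] at hj
    have h := TermModel.holds_of_pr hT (.ind (.ind A i j (Ne.symm hj.1) hj.2)) ρ
    simp only [holds_imp, holds_sub, holds_All, val_zero, val_var, val_eats] at h
    refine h h0 fun x y hx hy => ?_
    have e : ∀ a b c : TermModel hT, Holds (Function.update (Function.update (Function.update ρ
        i a) j b) i c) A ↔ Holds (Function.update ρ i c) A := fun a b c =>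
      holds_congr fun k hk => by
        have : k ≠ j := fun e => hj.2 (e ▸ hk)
        by_cases hki : k = i <;> simp [hki, this, Function.update]
    have e' : Holds (Function.update (Function.update ρ i x) j y) A ↔
        Holds (Function.update ρ i x) A :=
      holds_congr fun k hk => by
        have : k ≠ j := fun e => hj.2 (e ▸ hk)
        simp [this]
    rw [e'] at hx
    rw [e] at hy ⊢
    simpa [Ne.symm hj.1] using h1 x y hx (by simpa using hy)

/-- Completeness: what holds in all countable models is provable. -/
theorem completeness {extra A : Form}
    (h : ∀ (M : Type) [HFModel M] (ρ : ℕ → M), Holds ρ A) : Pr extra A := by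
  by_contra hA
  obtain ⟨T, hT, hAT⟩ := exists_henkin (C := Neg A) fun h' => hA (.dne₀ h')
  exact hT.neg_iff.1 hAT ((TermModel.holds_iff hT A).1 (h (TermModel hT) _))

/-! ## Definability in models -/

infix:50 " ε " => HFStr.mem
infixl:65 " ◁ " => HFStr.eats

section Definability

variable {M : Type} [HFModel M]

theorem exists_enum (M : Type) [HFModel M] : ∃ f : ℕ → M, Function.Surjective f :=
  haveI : Nonempty M := ⟨HFStr.zero⟩
  haveI := HFModel.countable (M := M)
  exists_surjective_nat M

/-- The assignment with values `e i` for the variables `2 * i`, in which every element of the model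
is the value of some variable `2 * i + 1`. -/
noncomputable def mix (e : ℕ → M) (n : ℕ) : M :=
  if n % 2 = 0 then e (n / 2) else (exists_enum M).choose (n / 2)

@[simp] theorem mix_even (e : ℕ → M) (n : ℕ) : mix e (2 * n) = e n := by simp [mix]

theorem mix_odd (e : ℕ → M) (n : ℕ) : mix e (2 * n + 1) = (exists_enum M).choose n := by
  have : (2 * n + 1) / 2 = n := by omega
  simp [mix, this]

/-- Definability with parameters, of a relation on assignments. -/
class Dfn (P : (ℕ → M) → Prop) : Prop where
  out : ∃ A : Form, ∀ e, P e ↔ Holds (mix e) A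

/-- Functions on assignments that are given by terms with parameters. -/
class DTm (f : (ℕ → M) → M) : Prop where
  out : ∃ t : Term, ∀ e, f e = t.val (mix e)

instance DTm.proj (n : ℕ) : DTm (fun e : ℕ → M => e n) := ⟨v (2 * n), by simp⟩

instance DTm.const (c : M) : DTm (fun _ : ℕ → M => c) := by
  obtain ⟨n, hn⟩ := (exists_enum M).choose_spec c
  exact ⟨v (2 * n + 1), by simp [mix_odd, hn]⟩

instance DTm.eats (f g : (ℕ → M) → M) [hf : DTm f] [hg : DTm g] : DTm (fun e => f e ◁ g e) := by
  obtain ⟨t, ht⟩ := hf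
  obtain ⟨u, hu⟩ := hg
  exact ⟨.eats t u, by simp [ht, hu]⟩

theorem Dfn.congr {P Q : (ℕ → M) → Prop} (hP : Dfn P) (h : ∀ e, Q e ↔ P e) : Dfn Q := by
  obtain ⟨A, hA⟩ := hP
  exact ⟨A, fun e => (h e).trans (hA e)⟩

instance Dfn.mem (f g : (ℕ → M) → M) [hf : DTm f] [hg : DTm g] : Dfn (fun e => f e ε g e) := by
  obtain ⟨t, ht⟩ := hf
  obtain ⟨u, hu⟩ := hg
  exact ⟨.mem t u, by simp [ht, hu]⟩

instance Dfn.eq (f g : (ℕ → M) → M) [hf : DTm f] [hg : DTm g] : Dfn (fun e => f e = g e) := by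
  obtain ⟨t, ht⟩ := hf
  obtain ⟨u, hu⟩ := hg
  exact ⟨.eq t u, by simp [ht, hu]⟩

instance Dfn.not (P : (ℕ → M) → Prop) [hP : Dfn P] : Dfn (fun e => ¬ P e) := by
  obtain ⟨A, hA⟩ := hP
  exact ⟨.neg A, by simp [hA]⟩

instance Dfn.or (P Q : (ℕ → M) → Prop) [hP : Dfn P] [hQ : Dfn Q] :
    Dfn (fun e => P e ∨ Q e) := by
  obtain ⟨A, hA⟩ := hP
  obtain ⟨B, hB⟩ := hQ
  exact ⟨.disj A B, by simp [hA, hB]⟩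

instance Dfn.and (P Q : (ℕ → M) → Prop) [hP : Dfn P] [hQ : Dfn Q] :
    Dfn (fun e => P e ∧ Q e) := by
  obtain ⟨A, hA⟩ := hP
  obtain ⟨B, hB⟩ := hQ
  exact ⟨Conj A B, by simp [hA, hB]⟩

instance Dfn.imp (P Q : (ℕ → M) → Prop) [hP : Dfn P] [hQ : Dfn Q] :
    Dfn (fun e => P e → Q e) := by
  obtain ⟨A, hA⟩ := hP
  obtain ⟨B, hB⟩ := hQ
  exact ⟨Imp A B, by simp [hA, hB]⟩

instance Dfn.iff (P Q : (ℕ → M) → Prop) [hP : Dfn P] [hQ : Dfn Q] :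
    Dfn (fun e => P e ↔ Q e) := by
  obtain ⟨A, hA⟩ := hP
  obtain ⟨B, hB⟩ := hQ
  exact ⟨Biimp A B, by simp [hA, hB]⟩

instance Dfn.ex (P : (ℕ → M) → M → Prop) [hP : Dfn (fun e => P (fun n => e (n + 1)) (e 0))] :
    Dfn (fun e => ∃ a, P e a) := by
  obtain ⟨A, hA⟩ := hP
  refine ⟨.ex ((A.abst 0).subst fun n => if n % 2 = 0 then v (n - 2) else v n), fun e => ?_⟩
  rw [holds_ex_iff]
  refine exists_congr fun a => ?_
  rw [Fm.sat_subst, Fm.sat_abst]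
  have : Function.update (fun i => Tm.val (mix e) (if i % 2 = 0 then v (i - 2) else v i)) 0 a =
      mix fun n => Nat.casesOn n a e := by
    ext n
    rcases Nat.even_or_odd' n with ⟨n, rfl | rfl⟩
    · cases n with
      | zero => rw [mix_even]; simp
      | succ n =>
        have h1 : 2 * (n + 1) - 2 = 2 * n := by omega
        rw [mix_even, Function.update_of_ne (by omega), if_pos (by omega), h1, val_var, mix_even]
    · rw [mix_odd, Function.update_of_ne (by omega), if_neg (by omega), val_var, mix_odd]
  rw [this]
  exact hA fun n => Nat.casesOn n a e

instance Dfn.all (P : (ℕ → M) → M → Prop) [hP : Dfn (fun e => P (fun n => e (n + 1)) (e 0))] :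
    Dfn (fun e => ∀ a, P e a) := by
  have := Dfn.ex fun e a => ¬ P e a
  exact (Dfn.not fun e => ∃ a, ¬ P e a).congr fun e => by simp

theorem Dfn.subst {P : (ℕ → M) → Prop} (hP : Dfn P) (f : ℕ → (ℕ → M) → M) (hf : ∀ i, DTm (f i)) :
    Dfn (fun e => P fun i => f i e) := by
  obtain ⟨A, hA⟩ := hP
  choose t ht using fun i => (hf i).out
  refine ⟨A.subst fun n => if n % 2 = 0 then t (n / 2) else v n, fun e => ?_⟩
  rw [hA, holds_subst]
  refine Iff.of_eq (congrArg (Holds · A) ?_)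
  ext n
  rcases Nat.even_or_odd' n with ⟨n, rfl | rfl⟩
  · rw [mix_even, if_pos (by omega), ht, Nat.mul_div_cancel_left _ (by omega)]
  · rw [mix_odd, if_neg (by omega), val_var, mix_odd]

theorem Dfn.comp₁ {P : M → Prop} (h : Dfn fun e => P (e 0)) (f : (ℕ → M) → M) [hf : DTm f] :
    Dfn fun e => P (f e) := h.subst (fun _ => f) fun _ => hf

theorem Dfn.comp₂ {P : M → M → Prop} (h : Dfn fun e => P (e 0) (e 1)) (f g : (ℕ → M) → M)
    [hf : DTm f] [hg : DTm g] : Dfn fun e => P (f e) (g e) :=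
  h.subst (fun i => if i = 0 then f else g) fun i => by split_ifs <;> assumption

theorem Dfn.comp₃ {P : M → M → M → Prop} (h : Dfn fun e => P (e 0) (e 1) (e 2))
    (f g k : (ℕ → M) → M) [hf : DTm f] [hg : DTm g] [hk : DTm k] :
    Dfn fun e => P (f e) (g e) (k e) :=
  h.subst (fun i => if i = 0 then f else if i = 1 then g else k) fun i => by
    split_ifs <;> assumption

/-- The relation defined by a formula is definable. -/
theorem Dfn.of_holds {P : (ℕ → M) → Prop} (A : Form) (h : ∀ ρ, Holds ρ A ↔ P ρ)
    (f : ℕ → (ℕ → M) → M) (hf : ∀ i, DTm (f i)) : Dfn fun e => P fun i => f i e := by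
  refine Dfn.subst ⟨A.subst fun n => v (2 * n), fun e => ?_⟩ f hf
  rw [holds_subst, ← h]
  simp

theorem Dfn.of_holds₁ {P : M → Prop} (A : Form) (h : ∀ ρ, Holds ρ A ↔ P (ρ 0))
    (f : (ℕ → M) → M) [hf : DTm f] : Dfn fun e => P (f e) :=
  Dfn.of_holds A h (fun _ => f) fun _ => hf

theorem Dfn.of_holds₂ {P : M → M → Prop} (A : Form) (h : ∀ ρ, Holds ρ A ↔ P (ρ 0) (ρ 1))
    (f g : (ℕ → M) → M) [hf : DTm f] [hg : DTm g] : Dfn fun e => P (f e) (g e) :=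
  Dfn.of_holds A h (fun i => if i = 0 then f else g) fun i => by split_ifs <;> assumption

theorem Dfn.of_holds₃ {P : M → M → M → Prop} (A : Form)
    (h : ∀ ρ, Holds ρ A ↔ P (ρ 0) (ρ 1) (ρ 2))
    (f g k : (ℕ → M) → M) [hf : DTm f] [hg : DTm g] [hk : DTm k] :
    Dfn fun e => P (f e) (g e) (k e) :=
  Dfn.of_holds A h (fun i => if i = 0 then f else if i = 1 then g else k) fun i => by
    split_ifs <;> assumption

theorem Dfn.of_holds₄ {P : M → M → M → M → Prop} (A : Form)
    (h : ∀ ρ, Holds ρ A ↔ P (ρ 0) (ρ 1) (ρ 2) (ρ 3))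
    (f g k l : (ℕ → M) → M) [hf : DTm f] [hg : DTm g] [hk : DTm k] [hl : DTm l] :
    Dfn fun e => P (f e) (g e) (k e) (l e) :=
  Dfn.of_holds A h (fun i => if i = 0 then f else if i = 1 then g else if i = 2 then k else l)
    fun i => by split_ifs <;> assumption

end Definability

/-! ## Sets in models -/

section Sets

variable {M : Type} [HFModel M]

theorem eats_induction {P : M → Prop} (hP : Dfn fun e => P (e 0)) (zero : P HFStr.zero)
    (eats : ∀ x y, P x → P y → P (x ◁ y)) (x : M) : P x := by
  obtain ⟨A, hA⟩ := hP
  have key : ∀ x, Holds (Function.update (mix fun _ => HFStr.zero) 0 x) A ↔ P x := fun x => by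
    have h0 := hA fun n => if n = 0 then x else HFStr.zero
    simp only [if_true] at h0
    rw [h0]
    refine Iff.of_eq (congrArg (Holds · A) ?_)
    ext n
    rcases Nat.even_or_odd' n with ⟨n, rfl | rfl⟩
    · cases n with
      | zero => rw [mix_even]; simp
      | succ n => rw [mix_even, Function.update_of_ne (by omega), mix_even]; simp
    · rw [mix_odd, Function.update_of_ne (by omega), mix_odd]
  simp only [← key] at *
  exact HFModel.ind A _ 0 zero eats x

theorem eq_zero_or_eats (x : M) : x = HFStr.zero ∨ ∃ y z, x = y ◁ z :=
  eats_induction (P := fun x => x = HFStr.zero ∨ ∃ y z, x = y ◁ z) inferInstance (.inl rfl)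
    (fun x y _ _ => .inr ⟨x, y, rfl⟩) x

@[simp] theorem mem_zero_iff (x : M) : x ε HFStr.zero ↔ False :=
  iff_false_intro (HFModel.not_mem_zero x)

@[simp] theorem mem_eats_iff (u x y : M) : u ε x ◁ y ↔ u ε x ∨ u = y := HFModel.mem_eats_iff x y u

theorem set_ext {x y : M} (h : ∀ u, u ε x ↔ u ε y) : x = y := by
  rcases eq_zero_or_eats x with rfl | ⟨a, b, rfl⟩
  · exact (HFModel.eq_zero y fun u hu => by simpa using (h u).2 hu).symm
  · exact (HFModel.eq_eats a b y fun u => by rw [← h]; simp).symm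

theorem mem_induction {P : M → Prop} (hP : Dfn fun e => P (e 0))
    (h : ∀ x, (∀ y, y ε x → P y) → P x) (x : M) : P x := by
  have inst (f : (ℕ → M) → M) [DTm f] : Dfn fun e => P (f e) := hP.comp₁ f
  refine h x (eats_induction (P := fun x => ∀ y, y ε x → P y) inferInstance (by simp) ?_ x)
  intro x y hx hy z hz
  rcases (mem_eats_iff _ _ _).1 hz with hz | rfl
  · exact hx z hz
  · exact h z hy

theorem mem_irrefl (x : M) : ¬ x ε x :=
  mem_induction (P := fun x => ¬ x ε x) inferInstance (fun x h hx => h x hx hx) x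

theorem exists_separation {P : M → Prop} (hP : Dfn fun e => P (e 0)) (x : M) :
    ∃ y, ∀ u, u ε y ↔ u ε x ∧ P u := by
  have inst (f : (ℕ → M) → M) [DTm f] : Dfn fun e => P (f e) := hP.comp₁ f
  refine eats_induction (P := fun x => ∃ y, ∀ u, u ε y ↔ u ε x ∧ P u) inferInstance
    ⟨HFStr.zero, by simp⟩ ?_ x
  rintro x a ⟨y, hy⟩ -
  by_cases ha : P a
  · refine ⟨y ◁ a, fun u => ?_⟩
    rw [mem_eats_iff, mem_eats_iff, hy]
    constructor
    · rintro (h | rfl)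
      exacts [⟨.inl h.1, h.2⟩, ⟨.inr rfl, ha⟩]
    · rintro ⟨h | rfl, h'⟩
      exacts [.inl ⟨h, h'⟩, .inr rfl]
  · refine ⟨y, fun u => ?_⟩
    rw [mem_eats_iff, hy]
    constructor
    · exact fun h => ⟨.inl h.1, h.2⟩
    · rintro ⟨h | rfl, h'⟩
      exacts [⟨h, h'⟩, absurd h' ha]

/-! ### Pairs -/

def pair (x y : M) : M := (HFStr.zero ◁ (HFStr.zero ◁ x)) ◁ ((HFStr.zero ◁ x) ◁ y)

instance DTm.pair (f g : (ℕ → M) → M) [DTm f] [DTm g] : DTm fun e => pair (f e) (g e) :=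
  inferInstanceAs (DTm fun e => (HFStr.zero ◁ (HFStr.zero ◁ f e)) ◁ ((HFStr.zero ◁ f e) ◁ g e))

theorem mem_pair_iff (u x y : M) :
    u ε pair x y ↔ u = HFStr.zero ◁ x ∨ u = (HFStr.zero ◁ x) ◁ y := by
  simp [pair]

theorem single_eq_iff {a b : M} : HFStr.zero ◁ a = HFStr.zero ◁ b ↔ a = b := by
  refine ⟨fun h => ?_, fun h => by rw [h]⟩
  have : a ε HFStr.zero ◁ b := h ▸ by simp
  simpa using this

theorem pair_inj {x y x' y' : M} (h : pair x y = pair x' y') : x = x' ∧ y = y' := by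
  have h1 : x = x' := by
    have : HFStr.zero ◁ x ε pair x' y' := h ▸ (mem_pair_iff ..).2 (.inl rfl)
    rcases (mem_pair_iff ..).1 this with h1 | h1
    · exact single_eq_iff.1 h1
    · have h2 : x' ε HFStr.zero ◁ x := h1 ▸ by simp
      exact Eq.symm (by simpa using h2)
  subst h1
  refine ⟨rfl, ?_⟩
  have key : ∀ y y' : M, pair x y = pair x y' → y = y' ∨ y = x := by
    intro y y' h
    have : (HFStr.zero ◁ x) ◁ y ε pair x y' := h ▸ (mem_pair_iff ..).2 (.inr rfl)
    rcases (mem_pair_iff ..).1 this with h1 | h1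
    · have h2 : y ε HFStr.zero ◁ x := h1 ▸ by simp
      exact .inr (by simpa using h2)
    · have h2 : y ε (HFStr.zero ◁ x) ◁ y' := h1 ▸ by simp
      simp only [mem_eats_iff, mem_zero_iff, false_or] at h2
      exact h2.symm
  rcases key y y' h with h1 | rfl
  · exact h1
  · rcases key y' y h.symm with h1 | h1
    exacts [h1.symm, h1.symm]

@[simp] theorem pair_eq_pair {x y x' y' : M} : pair x y = pair x' y' ↔ x = x' ∧ y = y' :=
  ⟨pair_inj, fun h => by rw [h.1, h.2]⟩

/-! ### Ordinals and sequences -/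

def IsSub (x y : M) : Prop := ∀ z, z ε x → z ε y

def IsOrd (x : M) : Prop := ∀ y, y ε x → IsSub y x ∧ ∀ z, z ε y → IsSub z y

def suc (x : M) : M := x ◁ x

def OrdNe (x y : M) : Prop := IsOrd x ∧ IsOrd y ∧ (x ε y ∨ y ε x)

def HFun (r : M) : Prop :=
  ∀ z, z ε r → ∀ z', z' ε r → ∃ x y x' y', z = pair x y ∧ z' = pair x' y' ∧ IsOrd x ∧ IsOrd x' ∧
    (OrdNe x x' ∨ y = y')

def LstSeq (s k y : M) : Prop :=
  IsOrd k ∧ (∀ x, x ε suc k → ∃ y, pair x y ε s) ∧ HFun s ∧ pair k y ε s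

instance DTm.suc (f : (ℕ → M) → M) [DTm f] : DTm fun e => suc (f e) :=
  inferInstanceAs (DTm fun e => f e ◁ f e)

instance Dfn.isSub (f g : (ℕ → M) → M) [DTm f] [DTm g] : Dfn fun e => IsSub (f e) (g e) :=
  (inferInstance : Dfn fun e : ℕ → M => ∀ z, z ε e 0 → z ε e 1).comp₂ f g

instance Dfn.isOrd (f : (ℕ → M) → M) [DTm f] : Dfn fun e => IsOrd (f e) :=
  (inferInstance : Dfn fun e : ℕ → M =>
    ∀ y, y ε e 0 → IsSub y (e 0) ∧ ∀ z, z ε y → IsSub z y).comp₁ (P := IsOrd) f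

instance Dfn.ordNe (f g : (ℕ → M) → M) [DTm f] [DTm g] : Dfn fun e => OrdNe (f e) (g e) :=
  (inferInstance : Dfn fun e : ℕ → M =>
    IsOrd (e 0) ∧ IsOrd (e 1) ∧ (e 0 ε e 1 ∨ e 1 ε e 0)).comp₂ f g

instance Dfn.hFun (f : (ℕ → M) → M) [DTm f] : Dfn fun e => HFun (f e) :=
  (inferInstance : Dfn fun e : ℕ → M =>
    ∀ z, z ε e 0 → ∀ z', z' ε e 0 → ∃ x y x' y', z = pair x y ∧ z' = pair x' y' ∧ IsOrd x ∧
      IsOrd x' ∧ (OrdNe x x' ∨ y = y')).comp₁ (P := HFun) f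

@[simp] theorem mem_suc_iff (x y : M) : x ε suc y ↔ x ε y ∨ x = y := mem_eats_iff ..

theorem IsOrd.zero : IsOrd (HFStr.zero : M) := by simp [IsOrd]

theorem IsOrd.trans {k l m : M} (hk : IsOrd k) (hl : l ε k) (hm : m ε l) : m ε k := (hk l hl).1 m hm

theorem IsOrd.mem {k l : M} (hk : IsOrd k) (hl : l ε k) : IsOrd l := fun m hm =>
  ⟨(hk l hl).2 m hm, (hk m (hk.trans hl hm)).2⟩

theorem IsOrd.suc {k : M} (hk : IsOrd k) : IsOrd (suc k) := by
  intro l hl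
  rcases (mem_suc_iff ..).1 hl with hl | rfl
  · exact ⟨fun m hm => (mem_suc_iff ..).2 (.inl (hk.trans hl hm)), (hk l hl).2⟩
  · exact ⟨fun m hm => (mem_suc_iff ..).2 (.inl hm), fun m hm => (hk m hm).1⟩

theorem HFun.unique {r x y y' : M} (h : HFun r) (hy : pair x y ε r) (hy' : pair x y' ε r) :
    y = y' := by
  obtain ⟨a, b, a', b', h1, h2, -, -, h3⟩ := h _ hy _ hy'
  obtain ⟨rfl, rfl⟩ := pair_inj h1
  obtain ⟨rfl, rfl⟩ := pair_inj h2
  rcases h3 with h3 | h3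
  · exact absurd (h3.2.2.elim id id) (mem_irrefl _)
  · exact h3

end Sets

/-! ## Inductive definitions by sequences -/

section Closure

variable {M : Type} [HFModel M] {B : M → Prop} {R : M → M → M → Prop}

/-- `p` satisfies `B`, or comes by `R` from two entries of `s` at positions in `l`. -/
def Entry (B : M → Prop) (R : M → M → M → Prop) (s l p : M) : Prop :=
  B p ∨ ∃ m n b c, m ε l ∧ n ε l ∧ pair m b ε s ∧ pair n c ε s ∧ R p b c

/-- `s` is a sequence up to `k` all of whose entries are justified. -/
def Deriv (B : M → Prop) (R : M → M → M → Prop) (s k : M) : Prop :=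
  IsOrd k ∧ HFun s ∧ ∀ l, l ε suc k → ∃ p, pair l p ε s ∧ Entry B R s l p

/-- The closure of `B` under `R`, as defined by sequences in the model. -/
def Cl (B : M → Prop) (R : M → M → M → Prop) (t : M) : Prop :=
  ∃ s k, Deriv B R s k ∧ pair k t ε s

theorem cl_iff {t : M} : Cl B R t ↔
    ∃ s k, LstSeq s k t ∧ ∀ l, l ε suc k → ∃ p, pair l p ε s ∧ Entry B R s l p := by
  refine exists_congr fun s => exists_congr fun k => ?_
  constructor
  · exact fun ⟨⟨hk, hs, h⟩, ht⟩ => ⟨⟨hk, fun l hl => (h l hl).imp fun _ => And.left, hs, ht⟩, h⟩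
  · exact fun ⟨⟨hk, _, hs, ht⟩, h⟩ => ⟨⟨hk, hs, h⟩, ht⟩

theorem Deriv.entry {s k l p : M} (h : Deriv B R s k) (hl : l ε suc k) (hp : pair l p ε s) :
    Entry B R s l p := by
  obtain ⟨q, hq, h'⟩ := h.2.2 l hl
  rwa [h.2.1.unique hp hq]

theorem Cl.ind {P : M → Prop} (hP : Dfn fun e => P (e 0)) (base : ∀ p, B p → P p)
    (step : ∀ p b c, R p b c → P b → P c → P p) {t : M} (ht : Cl B R t) : P t := by
  obtain ⟨s, k, h, ht⟩ := ht
  have inst (f : (ℕ → M) → M) [DTm f] : Dfn fun e => P (f e) := hP.comp₁ f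
  refine mem_induction (P := fun l => l ε suc k → ∀ p, pair l p ε s → P p) inferInstance ?_ k
    ((mem_suc_iff ..).2 (.inr rfl)) t ht
  intro l ih hl p hp
  rcases h.entry hl hp with hB | ⟨m, n, b, c, hm, hn, hb, hc, hR⟩
  · exact base p hB
  · exact step p b c hR (ih m hm (h.1.suc.trans hl hm) b hb) (ih n hn (h.1.suc.trans hl hn) c hc)

theorem Entry.mono {s s' l l' p : M} (h : Entry B R s l p)
    (hs : ∀ m b, m ε l → pair m b ε s → m ε l' ∧ pair m b ε s') : Entry B R s' l' p := by
  refine h.imp id ?_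
  rintro ⟨m, n, b, c, hm, hn, hb, hc, hR⟩
  exact ⟨m, n, b, c, (hs m b hm hb).1, (hs n c hn hc).1, (hs m b hm hb).2, (hs n c hn hc).2, hR⟩

theorem Deriv.append {s k t : M} (h : Deriv B R s k) (ht : Entry B R s (suc k) t) :
    ∃ s', Deriv B R s' (suc k) ∧ (∀ l p, l ε suc k → pair l p ε s → pair l p ε s') ∧
      pair (suc k) t ε s' := by
  obtain ⟨s₀, hs₀⟩ := exists_separation (P := fun z => ∃ l p, z = pair l p ∧ l ε suc k)
    inferInstance s
  have hs' : ∀ l p, pair l p ε s₀ ◁ pair (suc k) t ↔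
      (pair l p ε s ∧ l ε suc k) ∨ (l = suc k ∧ p = t) := by
    intro l p
    rw [mem_eats_iff, hs₀, pair_eq_pair]
    refine or_congr (and_congr_right fun _ => ?_) .rfl
    constructor
    · rintro ⟨l', p', e, hl⟩
      rwa [(pair_inj e).1]
    · exact fun hl => ⟨l, p, rfl, hl⟩
  have hk := h.1.suc
  refine ⟨s₀ ◁ pair (suc k) t, ⟨hk, ?_, ?_⟩, fun l p hl hp => (hs' l p).2 (.inl ⟨hp, hl⟩),
    (hs' _ _).2 (.inr ⟨rfl, rfl⟩)⟩
  · intro z hz z' hz'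
    have key : ∀ z, z ε s₀ ◁ pair (suc k) t →
        (z ε s ∧ ∃ l p, z = pair l p ∧ l ε suc k) ∨ z = pair (suc k) t := by
      intro z hz
      rw [mem_eats_iff, hs₀] at hz
      exact hz
    rcases key z hz with ⟨hz, l, p, rfl, hl⟩ | rfl <;>
      rcases key z' hz' with ⟨hz', l', p', rfl, hl'⟩ | rfl
    · exact h.2.1 _ hz _ hz'
    · exact ⟨l, p, suc k, t, rfl, rfl, hk.mem hl, hk, .inl ⟨hk.mem hl, hk, .inl hl⟩⟩
    · exact ⟨suc k, t, l', p', rfl, rfl, hk, hk.mem hl', .inl ⟨hk, hk.mem hl', .inr hl'⟩⟩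
    · exact ⟨suc k, t, suc k, t, rfl, rfl, hk, hk, .inr rfl⟩
  · intro l hl
    rcases (mem_suc_iff ..).1 hl with hl | rfl
    · obtain ⟨p, hp, hE⟩ := h.2.2 l hl
      exact ⟨p, (hs' l p).2 (.inl ⟨hp, hl⟩),
        hE.mono fun m b hm hb => ⟨hm, (hs' m b).2 (.inl ⟨hb, hk.trans hl hm⟩)⟩⟩
    · exact ⟨t, (hs' _ _).2 (.inr ⟨rfl, rfl⟩),
        ht.mono fun m b hm hb => ⟨hm, (hs' m b).2 (.inl ⟨hb, hm⟩)⟩⟩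

theorem Cl.base {t : M} (ht : B t) : Cl B R t := by
  refine ⟨HFStr.zero ◁ pair HFStr.zero t, HFStr.zero, ⟨.zero, ?_, ?_⟩, by simp⟩
  · intro z hz z' hz'
    simp only [mem_eats_iff, mem_zero_iff, false_or] at hz hz'
    exact ⟨_, _, _, _, hz, hz', .zero, .zero, .inr rfl⟩
  · intro l hl
    simp only [mem_suc_iff, mem_zero_iff, false_or] at hl
    exact ⟨t, by simp [hl], .inl ht⟩

/-- Every derivation can be extended so as to contain a given element of the closure. -/
theorem Cl.extend (hB : Dfn fun e => B (e 0)) (hR : Dfn fun e => R (e 0) (e 1) (e 2)) {t : M}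
    (ht : Cl B R t) : ∀ s k, Deriv B R s k → ∃ s' k', Deriv B R s' k' ∧
      (∀ l p, l ε suc k → pair l p ε s → l ε suc k' ∧ pair l p ε s') ∧
      ∃ m, m ε suc k' ∧ pair m t ε s' := by
  have instB (f : (ℕ → M) → M) [DTm f] : Dfn fun e => B (f e) := hB.comp₁ f
  have instR (f g k : (ℕ → M) → M) [DTm f] [DTm g] [DTm k] : Dfn fun e => R (f e) (g e) (k e) :=
    hR.comp₃ f g k
  have app : ∀ p s k, Deriv B R s k → Entry B R s (suc k) p →
      ∃ s' k', Deriv B R s' k' ∧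
        (∀ l p, l ε suc k → pair l p ε s → l ε suc k' ∧ pair l p ε s') ∧
        ∃ m, m ε suc k' ∧ pair m p ε s' := by
    intro p s k h hp
    obtain ⟨s', h', hs', ht'⟩ := h.append hp
    exact ⟨s', suc k, h', fun l q hl hq => ⟨(mem_suc_iff ..).2 (.inl hl), hs' l q hl hq⟩,
      suc k, (mem_suc_iff ..).2 (.inr rfl), ht'⟩
  refine Cl.ind ?_ (fun p hp s k h => app p s k h (.inl hp)) ?_ ht
  · have inst (f g : (ℕ → M) → M) [DTm f] [DTm g] : Dfn fun e => Deriv B R (f e) (g e) :=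
      (inferInstance : Dfn fun e : ℕ → M => IsOrd (e 1) ∧ HFun (e 0) ∧ ∀ l, l ε suc (e 1) →
        ∃ p, pair l p ε e 0 ∧ (B p ∨ ∃ m n b c, m ε l ∧ n ε l ∧ pair m b ε e 0 ∧
          pair n c ε e 0 ∧ R p b c)).comp₂ (P := Deriv B R) f g
    infer_instance
  · intro p b c hR hb hc s k h
    obtain ⟨s₁, k₁, h₁, e₁, m, hm, hbm⟩ := hb s k h
    obtain ⟨s₂, k₂, h₂, e₂, n, hn, hcn⟩ := hc s₁ k₁ h₁
    obtain ⟨s₃, k₃, h₃, e₃, h₄⟩ := app p s₂ k₂ h₂ (.inr ⟨m, n, b, c, (e₂ m b hm hbm).1, hn,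
      (e₂ m b hm hbm).2, hcn, hR⟩)
    refine ⟨s₃, k₃, h₃, fun l q hl hq => ?_, h₄⟩
    obtain ⟨hl, hq⟩ := e₁ l q hl hq
    obtain ⟨hl, hq⟩ := e₂ l q hl hq
    exact e₃ l q hl hq

theorem Cl.step (hB : Dfn fun e => B (e 0)) (hR : Dfn fun e => R (e 0) (e 1) (e 2)) {t b c : M}
    (hb : Cl B R b) (hc : Cl B R c) (h : R t b c) : Cl B R t := by
  obtain ⟨s, k, hs, hbk⟩ := hb
  obtain ⟨s', k', hs', e, n, hn, hcn⟩ := hc.extend hB hR s k hs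
  obtain ⟨hk, hbk⟩ := e k b ((mem_suc_iff ..).2 (.inr rfl)) hbk
  obtain ⟨s'', h'', -, ht⟩ := hs'.append (t := t) (.inr ⟨k, n, b, c, hk, hn, hbk, hcn, h⟩)
  exact ⟨s'', suc k', h'', ht⟩

end Closure

/-! ### Inductively defined relations -/

section Closure2

variable {M : Type} [HFModel M] {B : M → M → Prop} {R : M → M → M → M → M → M → Prop}

/-- The binary relation generated by `B` and `R`. -/
def Cl₂ (B : M → M → Prop) (R : M → M → M → M → M → M → Prop) (t t' : M) : Prop :=
  Cl (fun p => ∃ a a', p = pair a a' ∧ B a a')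
    (fun p q r => ∃ a a' b b' c c', p = pair a a' ∧ q = pair b b' ∧ r = pair c c' ∧
      R a a' b b' c c') (pair t t')

theorem cl₂_iff {t t' : M} : Cl₂ B R t t' ↔
    ∃ s k, LstSeq s k (pair t t') ∧ ∀ l, l ε suc k → ∃ a a', pair l (pair a a') ε s ∧
      (B a a' ∨ ∃ m n b b' c c', m ε l ∧ n ε l ∧ pair m (pair b b') ε s ∧
        pair n (pair c c') ε s ∧ R a a' b b' c c') := by
  rw [Cl₂, cl_iff]
  refine exists_congr fun s => exists_congr fun k => and_congr_right fun _ =>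
    forall_congr' fun l => imp_congr_right fun _ => ?_
  constructor
  · rintro ⟨p, hp, ⟨a, a', rfl, h⟩ | ⟨m, n, _, _, hm, hn, hb, hc, a, a', b, b', c, c', rfl, rfl,
      rfl, h⟩⟩
    · exact ⟨a, a', hp, .inl h⟩
    · exact ⟨a, a', hp, .inr ⟨m, n, b, b', c, c', hm, hn, hb, hc, h⟩⟩
  · rintro ⟨a, a', hp, h | ⟨m, n, b, b', c, c', hm, hn, hb, hc, h⟩⟩
    · exact ⟨_, hp, .inl ⟨a, a', rfl, h⟩⟩
    · exact ⟨_, hp, .inr ⟨m, n, _, _, hm, hn, hb, hc, a, a', b, b', c, c', rfl, rfl, rfl, h⟩⟩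

theorem Cl₂.base {t t' : M} (h : B t t') : Cl₂ B R t t' := Cl.base ⟨t, t', rfl, h⟩

theorem Cl₂.step (hB : Dfn fun e => B (e 0) (e 1))
    (hR : Dfn fun e => R (e 0) (e 1) (e 2) (e 3) (e 4) (e 5)) {t t' b b' c c' : M}
    (hb : Cl₂ B R b b') (hc : Cl₂ B R c c') (h : R t t' b b' c c') : Cl₂ B R t t' := by
  have instB (f g : (ℕ → M) → M) [DTm f] [DTm g] : Dfn fun e => B (f e) (g e) :=
    hB.comp₂ f g
  have instR (f₀ f₁ f₂ f₃ f₄ f₅ : (ℕ → M) → M) [DTm f₀] [DTm f₁] [DTm f₂] [DTm f₃] [DTm f₄]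
      [DTm f₅] : Dfn fun e => R (f₀ e) (f₁ e) (f₂ e) (f₃ e) (f₄ e) (f₅ e) :=
    hR.subst (fun i => if i = 0 then f₀ else if i = 1 then f₁ else if i = 2 then f₂ else
      if i = 3 then f₃ else if i = 4 then f₄ else f₅) fun i => by split_ifs <;> assumption
  exact Cl.step inferInstance inferInstance hb hc ⟨t, t', b, b', c, c', rfl, rfl, rfl, h⟩

theorem Cl₂.ind {P : M → M → Prop} (hP : Dfn fun e => P (e 0) (e 1))
    (base : ∀ a a', B a a' → P a a')
    (step : ∀ a a' b b' c c', R a a' b b' c c' → P b b' → P c c' → P a a') {t t' : M}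
    (ht : Cl₂ B R t t') : P t t' := by
  have inst (f g : (ℕ → M) → M) [DTm f] [DTm g] : Dfn fun e => P (f e) (g e) :=
    hP.comp₂ f g
  refine Cl.ind (P := fun p => ∀ a a', p = pair a a' → P a a') inferInstance ?_ ?_ ht t t' rfl
  · rintro _ ⟨a, a', rfl, h⟩ x x' e
    obtain ⟨rfl, rfl⟩ := pair_inj e
    exact base a a' h
  · rintro _ _ _ ⟨a, a', b, b', c, c', rfl, rfl, rfl, h⟩ hb hc x x' e
    obtain ⟨rfl, rfl⟩ := pair_inj e
    exact step a a' b b' c c' h (hb b b' rfl) (hc c c' rfl)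

end Closure2

section Closure3

variable {M : Type} [HFModel M] {B : M → M → M → Prop}
  {R : M → M → M → M → M → M → M → M → M → Prop}

/-- The ternary relation generated by `B` and `R`. -/
def Cl₃ (B : M → M → M → Prop) (R : M → M → M → M → M → M → M → M → M → Prop) (i t t' : M) : Prop :=
  Cl (fun p => ∃ j a a', p = pair j (pair a a') ∧ B j a a')
    (fun p q r => ∃ j a a' jb b b' jc c c', p = pair j (pair a a') ∧ q = pair jb (pair b b') ∧
      r = pair jc (pair c c') ∧ R j a a' jb b b' jc c c') (pair i (pair t t'))

theorem cl₃_iff {i t t' : M} : Cl₃ B R i t t' ↔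
    ∃ s k, LstSeq s k (pair i (pair t t')) ∧ ∀ l, l ε suc k →
      ∃ j a a', pair l (pair j (pair a a')) ε s ∧
      (B j a a' ∨ ∃ m n jb b b' jc c c', m ε l ∧ n ε l ∧ pair m (pair jb (pair b b')) ε s ∧
        pair n (pair jc (pair c c')) ε s ∧ R j a a' jb b b' jc c c') := by
  rw [Cl₃, cl_iff]
  refine exists_congr fun s => exists_congr fun k => and_congr_right fun _ =>
    forall_congr' fun l => imp_congr_right fun _ => ?_
  constructor
  · rintro ⟨p, hp, ⟨j, a, a', rfl, h⟩ | ⟨m, n, _, _, hm, hn, hb, hc, j, a, a', jb, b, b', jc, c, c',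
      rfl, rfl, rfl, h⟩⟩
    · exact ⟨j, a, a', hp, .inl h⟩
    · exact ⟨j, a, a', hp, .inr ⟨m, n, jb, b, b', jc, c, c', hm, hn, hb, hc, h⟩⟩
  · rintro ⟨j, a, a', hp, h | ⟨m, n, jb, b, b', jc, c, c', hm, hn, hb, hc, h⟩⟩
    · exact ⟨_, hp, .inl ⟨j, a, a', rfl, h⟩⟩
    · exact ⟨_, hp, .inr ⟨m, n, _, _, hm, hn, hb, hc, j, a, a', jb, b, b', jc, c, c', rfl, rfl, rfl,
        h⟩⟩

theorem Cl₃.base {i t t' : M} (h : B i t t') : Cl₃ B R i t t' := Cl.base ⟨i, t, t', rfl, h⟩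

theorem Cl₃.step (hB : Dfn fun e => B (e 0) (e 1) (e 2))
    (hR : Dfn fun e => R (e 0) (e 1) (e 2) (e 3) (e 4) (e 5) (e 6) (e 7) (e 8))
    {i t t' jb b b' jc c c' : M} (hb : Cl₃ B R jb b b') (hc : Cl₃ B R jc c c')
    (h : R i t t' jb b b' jc c c') : Cl₃ B R i t t' := by
  have instB (f g k : (ℕ → M) → M) [DTm f] [DTm g] [DTm k] : Dfn fun e => B (f e) (g e) (k e) :=
    hB.comp₃ f g k
  have instR (f₀ f₁ f₂ f₃ f₄ f₅ f₆ f₇ f₈ : (ℕ → M) → M) [DTm f₀] [DTm f₁] [DTm f₂] [DTm f₃]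
      [DTm f₄] [DTm f₅] [DTm f₆] [DTm f₇] [DTm f₈] :
      Dfn fun e => R (f₀ e) (f₁ e) (f₂ e) (f₃ e) (f₄ e) (f₅ e) (f₆ e) (f₇ e) (f₈ e) :=
    hR.subst (fun i => if i = 0 then f₀ else if i = 1 then f₁ else if i = 2 then f₂ else
      if i = 3 then f₃ else if i = 4 then f₄ else if i = 5 then f₅ else if i = 6 then f₆ else
      if i = 7 then f₇ else f₈) fun i => by split_ifs <;> assumption
  exact Cl.step inferInstance inferInstance hb hc
    ⟨i, t, t', jb, b, b', jc, c, c', rfl, rfl, rfl, h⟩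

end Closure3

/-! ## The predicates of the calculus in models -/

section Predicates

variable {M : Type} [HFModel M]

/-! ### Codes -/

def htuple : ℕ → M
  | 0 => pair HFStr.zero HFStr.zero
  | k + 1 => pair HFStr.zero (htuple k)

def ordN : ℕ → M
  | 0 => HFStr.zero
  | k + 1 => suc (ordN k)

def qMem (t u : M) : M := pair (htuple 0) (pair t u)
def qEats (t u : M) : M := pair (htuple 1) (pair t u)
def qEq (t u : M) : M := pair (htuple 2) (pair t u)
def qDisj (t u : M) : M := pair (htuple 3) (pair t u)
def qNeg (t : M) : M := pair (htuple 4) t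
def qEx (t : M) : M := pair (htuple 5) t
def qInd (t : M) : M := pair (htuple 6) t
def qImp (t u : M) : M := qDisj (qNeg t) u
def qAll (t : M) : M := qNeg (qEx (qNeg t))

section

variable (f g : (ℕ → M) → M) [DTm f] [DTm g]

instance DTm.qMem : DTm fun e => qMem (f e) (g e) :=
  inferInstanceAs (DTm fun e => HFCalc.pair (htuple 0) (HFCalc.pair (f e) (g e)))
instance DTm.qEats : DTm fun e => qEats (f e) (g e) :=
  inferInstanceAs (DTm fun e => HFCalc.pair (htuple 1) (HFCalc.pair (f e) (g e)))
instance DTm.qDisj : DTm fun e => qDisj (f e) (g e) :=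
  inferInstanceAs (DTm fun e => HFCalc.pair (htuple 3) (HFCalc.pair (f e) (g e)))
instance DTm.qNeg : DTm fun e => qNeg (f e) :=
  inferInstanceAs (DTm fun e => HFCalc.pair (htuple 4) (f e))
instance DTm.qEx : DTm fun e => qEx (f e) :=
  inferInstanceAs (DTm fun e => HFCalc.pair (htuple 5) (f e))
instance DTm.qInd : DTm fun e => qInd (f e) :=
  inferInstanceAs (DTm fun e => HFCalc.pair (htuple 6) (f e))
instance DTm.qImp : DTm fun e => qImp (f e) (g e) :=
  inferInstanceAs (DTm fun e => HFCalc.qDisj (HFCalc.qNeg (f e)) (g e))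

end

section

variable (ρ : ℕ → M) (t u : Term)

@[simp] theorem val_HPair : (HPair t u).val ρ = pair (t.val ρ) (u.val ρ) := rfl
@[simp] theorem val_succ : (succ t).val ρ = suc (t.val ρ) := rfl
@[simp] theorem val_HTuple (k : ℕ) : (HTuple k).val ρ = htuple k := by
  induction k with
  | zero => rfl
  | succ k ih => simp [HTuple, htuple, ih]
@[simp] theorem val_ordOf (k : ℕ) : (ordOf k).val ρ = ordN k := by
  induction k with
  | zero => rfl
  | succ k ih => simp [ordOf, ordN, ih]
@[simp] theorem val_QMem : (QMem t u).val ρ = qMem (t.val ρ) (u.val ρ) := by simp [QMem, qMem]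
@[simp] theorem val_QEats : (QEats t u).val ρ = qEats (t.val ρ) (u.val ρ) := by
  simp [QEats, qEats]
@[simp] theorem val_QEq : (QEq t u).val ρ = qEq (t.val ρ) (u.val ρ) := by simp [QEq, qEq]
@[simp] theorem val_QDisj : (QDisj t u).val ρ = qDisj (t.val ρ) (u.val ρ) := by
  simp [QDisj, qDisj]
@[simp] theorem val_QNeg : (QNeg t).val ρ = qNeg (t.val ρ) := by simp [QNeg, qNeg]
@[simp] theorem val_QEx : (QEx t).val ρ = qEx (t.val ρ) := by simp [QEx, qEx]
@[simp] theorem val_QInd : (QInd t).val ρ = qInd (t.val ρ) := by simp [QInd, qInd]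
@[simp] theorem val_QImp : (QImp t u).val ρ = qImp (t.val ρ) (u.val ρ) := by simp [QImp, qImp]
@[simp] theorem val_QAll : (QAll t).val ρ = qAll (t.val ρ) := by simp [QAll, qAll]

end

/-! ### Ordinals and sequences -/

section

variable (ρ : ℕ → M) (t u w : Term)

@[simp] theorem holds_All2 (i : ℕ) (A : Form) : Holds ρ (All2 i t A) ↔
    ∀ a, a ε t.val (Function.update ρ i a) → Holds (Function.update ρ i a) A := by
  simp [All2]

@[simp] theorem holds_Exs_nil (A : Form) : Holds ρ (Exs [] A) ↔ Holds ρ A := .rfl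
@[simp] theorem holds_Exs_cons (i : ℕ) (l : List ℕ) (A : Form) :
    Holds ρ (Exs (i :: l) A) ↔ ∃ a, Holds (Function.update ρ i a) (Exs l A) := holds_Ex ..

@[simp] theorem holds_Subset : Holds ρ (t SUBS u) ↔ IsSub (t.val ρ) (u.val ρ) := by
  simp [Subset, holds_inst, subsetBody, IsSub]

@[simp] theorem holds_OrdP : Holds ρ (OrdP t) ↔ IsOrd (t.val ρ) := by
  simp [OrdP, holds_inst, ordBody, IsOrd]

@[simp] theorem holds_OrdNeP : Holds ρ (OrdNeP t u) ↔ OrdNe (t.val ρ) (u.val ρ) := by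
  simp [OrdNeP, OrdNe]

def IsVar (x : M) : Prop := IsOrd x ∧ HFStr.zero ε x

@[simp] theorem holds_VarP : Holds ρ (VarP t) ↔ IsVar (t.val ρ) := by
  simp [VarP, IsVar]

@[simp] theorem holds_HFunP : Holds ρ (HFunP t) ↔ HFun (t.val ρ) := by
  simp [HFunP, holds_inst, hfunBody, HFun]

@[simp] theorem holds_DomInclP : Holds ρ (DomInclP t u) ↔
    ∀ x, x ε u.val ρ → ∃ y, pair x y ε t.val ρ := by
  simp [DomInclP, holds_inst, domInclBody]

@[simp] theorem holds_LstSeqP :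
    Holds ρ (LstSeqP t u w) ↔ LstSeq (t.val ρ) (u.val ρ) (w.val ρ) := by
  simp [LstSeqP, LstSeq]

/-! ### The relation `QR` and codes of terms -/

def IsQR : M → M → Prop :=
  Cl₂ (fun a a' => a = HFStr.zero ∧ a' = HFStr.zero)
    (fun a a' b b' c c' => a = b ◁ c ∧ a' = qEats b' c')

theorem holds_QR : Holds ρ (QR t u) ↔ IsQR (t.val ρ) (u.val ρ) := by
  simp [QR, holds_inst, qrBody, SeqQR, seqQRBody, IsQR, cl₂_iff]

def IsTerm : M → Prop := Cl (fun a => a = HFStr.zero ∨ IsVar a) (fun a b c => a = qEats b c)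

@[simp] theorem holds_TermP : Holds ρ (TermP t) ↔ IsTerm (t.val ρ) := by
  simp [TermP, holds_inst, termBody, SeqTermP, seqTermBody, IsTerm, cl_iff, Entry, or_assoc]

def IsInd (t : M) : Prop := ∃ k, IsOrd k ∧ t = qInd k

@[simp] theorem holds_IndP : Holds ρ (IndP t) ↔ IsInd (t.val ρ) := by
  simp [IndP, holds_inst, indBody, IsInd]

def StTerm (x u : M) : M → M → Prop :=
  Cl₂ (fun a a' => (a = x ∧ a' = u) ∨ ((IsInd a ∨ OrdNe a x) ∧ a' = a))
    (fun a a' b b' c c' => a = qEats b c ∧ a' = qEats b' c')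

def SubstTerm (x u t t' : M) : Prop := IsVar x ∧ IsTerm u ∧ StTerm x u t t'

@[simp] theorem holds_SubstTermP (x u t t' : Term) : Holds ρ (SubstTermP x u t t') ↔
    SubstTerm (x.val ρ) (u.val ρ) (t.val ρ) (t'.val ρ) := by
  simp [SubstTermP, holds_inst, substTermBody, SubstTerm, SeqStTermP, seqStTermBody, StTerm,
    cl₂_iff, or_assoc]

def AbstTerm (x i t t' : M) : Prop := IsVar x ∧ IsOrd i ∧ StTerm x (qInd i) t t'

@[simp] theorem holds_AbstTermP (x i t t' : Term) : Holds ρ (AbstTermP x i t t') ↔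
    AbstTerm (x.val ρ) (i.val ρ) (t.val ρ) (t'.val ρ) := by
  simp [AbstTermP, holds_inst, abstTermBody, AbstTerm, SeqStTermP, seqStTermBody, StTerm,
    cl₂_iff, or_assoc]

/-! ### Substitution and abstraction on codes of formulas -/

def SubstAtomic (x w y y' : M) : Prop :=
  ∃ t u t' u', SubstTerm x w t t' ∧ SubstTerm x w u u' ∧
    ((y = qEq t u ∧ y' = qEq t' u') ∨ (y = qMem t u ∧ y' = qMem t' u'))

@[simp] theorem holds_SubstAtomicP (x w y y' : Term) : Holds ρ (SubstAtomicP x w y y') ↔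
    SubstAtomic (x.val ρ) (w.val ρ) (y.val ρ) (y'.val ρ) := by
  simp [SubstAtomicP, holds_inst, substAtomicBody, SubstAtomic]

def SubstForm (x w y y' : M) : Prop :=
  IsVar x ∧ IsTerm w ∧ Cl₂ (SubstAtomic x w) (fun a a' b b' c c' =>
    (a = qDisj b c ∧ a' = qDisj b' c') ∨ (a = qNeg b ∧ a' = qNeg b') ∨
      (a = qEx b ∧ a' = qEx b')) y y'

@[simp] theorem holds_SubstFormP (x w y y' : Term) : Holds ρ (SubstFormP x w y y') ↔
    SubstForm (x.val ρ) (w.val ρ) (y.val ρ) (y'.val ρ) := by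
  simp [SubstFormP, holds_inst, substFormBody, SeqSubstFormP, seqSubstFormBody, SubstForm, cl₂_iff]

def AbstAtomic (x i y y' : M) : Prop :=
  ∃ t u t' u', AbstTerm x i t t' ∧ AbstTerm x i u u' ∧
    ((y = qEq t u ∧ y' = qEq t' u') ∨ (y = qMem t u ∧ y' = qMem t' u'))

@[simp] theorem holds_AbstAtomicP (x w y y' : Term) : Holds ρ (AbstAtomicP x w y y') ↔
    AbstAtomic (x.val ρ) (w.val ρ) (y.val ρ) (y'.val ρ) := by
  simp [AbstAtomicP, holds_inst, abstAtomicBody, AbstAtomic]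

def AbstStep (j a a' jb b b' jc c c' : M) : Prop :=
  (jb = j ∧ jc = j ∧ a = qDisj b c ∧ a' = qDisj b' c') ∨ (jb = j ∧ a = qNeg b ∧ a' = qNeg b') ∨
    (jb = suc j ∧ a = qEx b ∧ a' = qEx b')

def AbstForm (x i y y' : M) : Prop :=
  IsVar x ∧ IsOrd i ∧ Cl₃ (AbstAtomic x)
    (fun j a a' jb b b' jc c c' => IsOrd j ∧ AbstStep j a a' jb b b' jc c c') i y y'

set_option maxHeartbeats 1000000 in
@[simp] theorem holds_AbstFormP (x i y y' : Term) : Holds ρ (AbstFormP x i y y') ↔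
    AbstForm (x.val ρ) (i.val ρ) (y.val ρ) (y'.val ρ) := by
  simp [AbstFormP, holds_inst, abstFormBody, SeqAbstFormP, seqAbstFormBody, AbstForm, AbstStep,
    cl₃_iff, and_left_comm (b := IsOrd _)]

/-! ### Codes of formulas -/

def IsAtomic (y : M) : Prop := ∃ t u, IsTerm t ∧ IsTerm u ∧ (y = qEq t u ∨ y = qMem t u)

@[simp] theorem holds_AtomicP : Holds ρ (AtomicP t) ↔ IsAtomic (t.val ρ) := by
  simp [AtomicP, holds_inst, atomicBody, IsAtomic]

def MakeForm (y b c : M) : Prop :=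
  y = qDisj b c ∨ y = qNeg b ∨ ∃ x b', AbstForm x HFStr.zero b b' ∧ y = qEx b'

@[simp] theorem holds_MakeFormP :
    Holds ρ (MakeFormP t u w) ↔ MakeForm (t.val ρ) (u.val ρ) (w.val ρ) := by
  simp [MakeFormP, holds_inst, makeFormBody, MakeForm]

def IsForm : M → Prop := Cl IsAtomic MakeForm

@[simp] theorem holds_FormP : Holds ρ (FormP t) ↔ IsForm (t.val ρ) := by
  simp [FormP, holds_inst, formBody, SeqFormP, seqFormBody, IsForm, cl_iff, Entry]

def VarNonOcc (x y : M) : Prop := IsForm y ∧ SubstForm x HFStr.zero y y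

@[simp] theorem holds_VarNonOccFormP :
    Holds ρ (VarNonOccFormP t u) ↔ VarNonOcc (t.val ρ) (u.val ρ) := by
  simp [VarNonOccFormP, VarNonOcc]

/-! ### Axioms and provability -/

def IsBooleanAx (y : M) : Prop :=
  ∃ a b c, IsForm a ∧ IsForm b ∧ IsForm c ∧
    (y = qImp a a ∨ y = qImp a (qDisj a b) ∨ y = qImp (qDisj a a) a ∨
      y = qImp (qDisj a (qDisj b c)) (qDisj (qDisj a b) c) ∨
      y = qImp (qDisj c a) (qImp (qDisj (qNeg c) b) (qDisj a b)))

@[simp] theorem holds_BooleanAxP : Holds ρ (BooleanAxP t) ↔ IsBooleanAx (t.val ρ) := by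
  simp [BooleanAxP, holds_inst, booleanAxBody, IsBooleanAx]

def IsSpecialAx (y : M) : Prop :=
  ∃ x t a b c, IsForm a ∧ SubstForm x t a b ∧ AbstForm x HFStr.zero a c ∧ y = qImp b (qEx c)

@[simp] theorem holds_SpecialAxP : Holds ρ (SpecialAxP t) ↔ IsSpecialAx (t.val ρ) := by
  simp [SpecialAxP, holds_inst, specialAxBody, IsSpecialAx]

def IsInductionAx (y : M) : Prop :=
  ∃ x w a a0 aw axw b c ca, OrdNe x w ∧ VarNonOcc w a ∧ SubstForm x HFStr.zero a a0 ∧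
    SubstForm x w a aw ∧ SubstForm x (qEats x w) a axw ∧
    AbstForm w HFStr.zero (qImp a (qImp aw axw)) b ∧ AbstForm x HFStr.zero (qAll b) c ∧
    AbstForm x HFStr.zero a ca ∧ y = qImp a0 (qImp (qAll c) (qAll ca))

@[simp] theorem holds_InductionAxP : Holds ρ (InductionAxP t) ↔ IsInductionAx (t.val ρ) := by
  simp [InductionAxP, holds_inst, inductionAxBody, IsInductionAx]

end

/-- The code of a term, where the free variable `i` is replaced by `ρ i`. -/
def Tm.code (ρ : ℕ → M) {n : ℕ} : Tm n → M
  | .zero => HFStr.zero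
  | .var i => ρ i
  | .bnd k => qInd (ordN k)
  | .eats t u => qEats (t.code ρ) (u.code ρ)

/-- The code of a formula, where the free variable `i` is replaced by `ρ i`. -/
def Fm.code (ρ : ℕ → M) : {n : ℕ} → Fm n → M
  | _, .mem t u => qMem (t.code ρ) (u.code ρ)
  | _, .eq t u => qEq (t.code ρ) (u.code ρ)
  | _, .disj A B => qDisj (A.code ρ) (B.code ρ)
  | _, .neg A => qNeg (A.code ρ)
  | _, .ex A => qEx (A.code ρ)

/-- The codes of the variables. -/
def stdVar (i : ℕ) : M := ordN (i + 1)

theorem Tm.val_vquot (ρ : ℕ → M) (V : Finset ℕ) {n : ℕ} (t : Tm n) :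
    (t.vquot V).val ρ = t.code fun i => if i ∈ V then ρ i else stdVar i := by
  induction t with
  | zero => simp [Tm.vquot, Tm.code]
  | var i => by_cases h : i ∈ V <;> simp [Tm.vquot, Tm.code, h, stdVar]
  | bnd k => simp [Tm.vquot, Tm.code]
  | eats t u ht hu => simp [Tm.vquot, Tm.code, ht, hu]

theorem Fm.val_vquot (ρ : ℕ → M) (V : Finset ℕ) {n : ℕ} (A : Fm n) :
    (A.vquot V).val ρ = A.code fun i => if i ∈ V then ρ i else stdVar i := by
  induction A with
  | mem t u | eq t u => simp [Fm.vquot, Fm.code, Tm.val_vquot]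
  | disj A B hA hB => simp [Fm.vquot, Fm.code, hA, hB]
  | neg A hA => simp [Fm.vquot, Fm.code, hA]
  | ex A hA => simp [Fm.vquot, Fm.code, hA]

@[simp] theorem Fm.val_quot (ρ : ℕ → M) (A : Form) : A.quot.val ρ = A.code stdVar := by
  simp [Fm.quot, Fm.val_vquot]

def IsAxiom (extra : Form) (y : M) : Prop :=
  y = extra.code stdVar ∨ IsBooleanAx y ∨
    (y = reflAx.code stdVar ∨ y = eqCongAx.code stdVar ∨ y = memCongAx.code stdVar ∨
      y = eatsCongAx.code stdVar) ∨
    (y = hf1.code stdVar ∨ y = hf2.code stdVar) ∨ IsSpecialAx y ∨ IsInductionAx y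

def ExistsRule (p q : M) : Prop :=
  ∃ a a' b x, IsForm a ∧ VarNonOcc x b ∧ AbstForm x HFStr.zero a a' ∧ p = qImp a b ∧
    q = qImp (qEx a') b

def SubstRule (p q : M) : Prop := ∃ x t, SubstForm x t p q

def ProofStep (a b c : M) : Prop := b = qImp c a ∨ ExistsRule b a ∨ SubstRule b a

def IsPf (extra : Form) : M → Prop := Cl (IsAxiom extra) ProofStep

section

variable (ρ : ℕ → M) (t u w : Term)

@[simp] theorem holds_AxiomP (extra : Form) :
    Holds ρ (AxiomP extra t) ↔ IsAxiom extra (t.val ρ) := by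
  simp [AxiomP, EqualityAxP, HFAxP, IsAxiom]

@[simp] theorem holds_ExistsP : Holds ρ (ExistsP t u) ↔ ExistsRule (t.val ρ) (u.val ρ) := by
  simp [ExistsP, holds_inst, existsBody, ExistsRule]

@[simp] theorem holds_SubstRuleP : Holds ρ (SubstRuleP t u) ↔ SubstRule (t.val ρ) (u.val ρ) := by
  simp [SubstRuleP, holds_inst, substRuleBody, SubstRule]

theorem holds_PfP (extra : Form) : Holds ρ (PfP extra t) ↔ IsPf extra (t.val ρ) := by
  simp [PfP, holds_inst, pfBody, PrfP, prfBody, ModPonP, IsPf, cl_iff, Entry, ProofStep]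

end

/-! ### Definability -/

section

variable (f g k l : (ℕ → M) → M) [DTm f] [DTm g] [DTm k] [DTm l]

instance Dfn.isVar : Dfn fun e => IsVar (f e) :=
  inferInstanceAs (Dfn fun e => IsOrd (f e) ∧ HFStr.zero ε f e)
instance Dfn.isQR : Dfn fun e => IsQR (f e) (g e) :=
  Dfn.of_holds₂ (QR (v 0) (v 1)) (fun ρ => holds_QR ρ _ _) f g
instance Dfn.isTerm : Dfn fun e => IsTerm (f e) :=
  Dfn.of_holds₁ (TermP (v 0)) (fun ρ => holds_TermP ρ _) f
instance Dfn.isInd : Dfn fun e => IsInd (f e) :=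
  Dfn.of_holds₁ (IndP (v 0)) (fun ρ => holds_IndP ρ _) f
instance Dfn.substTerm : Dfn fun e => SubstTerm (f e) (g e) (k e) (l e) :=
  Dfn.of_holds₄ (SubstTermP (v 0) (v 1) (v 2) (v 3)) (fun ρ => holds_SubstTermP ρ _ _ _ _) f g k l
instance Dfn.substAtomic : Dfn fun e => SubstAtomic (f e) (g e) (k e) (l e) :=
  Dfn.of_holds₄ (SubstAtomicP (v 0) (v 1) (v 2) (v 3)) (fun ρ => holds_SubstAtomicP ρ _ _ _ _)
    f g k l
instance Dfn.abstAtomic : Dfn fun e => AbstAtomic (f e) (g e) (k e) (l e) :=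
  Dfn.of_holds₄ (AbstAtomicP (v 0) (v 1) (v 2) (v 3)) (fun ρ => holds_AbstAtomicP ρ _ _ _ _)
    f g k l
instance Dfn.isAtomic : Dfn fun e => IsAtomic (f e) :=
  Dfn.of_holds₁ (AtomicP (v 0)) (fun ρ => holds_AtomicP ρ _) f
instance Dfn.makeForm : Dfn fun e => MakeForm (f e) (g e) (k e) :=
  Dfn.of_holds₃ (MakeFormP (v 0) (v 1) (v 2)) (fun ρ => holds_MakeFormP ρ _ _ _) f g k
instance Dfn.isAxiom (extra : Form) : Dfn fun e => IsAxiom extra (f e) :=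
  Dfn.of_holds₁ (AxiomP extra (v 0)) (fun ρ => holds_AxiomP ρ _ _) f
instance Dfn.existsRule : Dfn fun e => ExistsRule (f e) (g e) :=
  Dfn.of_holds₂ (ExistsP (v 0) (v 1)) (fun ρ => holds_ExistsP ρ _ _) f g
instance Dfn.substRule : Dfn fun e => SubstRule (f e) (g e) :=
  Dfn.of_holds₂ (SubstRuleP (v 0) (v 1)) (fun ρ => holds_SubstRuleP ρ _ _) f g
instance Dfn.proofStep : Dfn fun e => ProofStep (f e) (g e) (k e) :=
  inferInstanceAs (Dfn fun e => g e = qImp (k e) (f e) ∨ ExistsRule (g e) (f e) ∨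
    SubstRule (g e) (f e))
instance Dfn.isPf (extra : Form) : Dfn fun e => IsPf extra (f e) :=
  Dfn.of_holds₁ (PfP extra (v 0)) (fun ρ => holds_PfP ρ _ _) f

end

end Predicates

/-! ## Representability of the syntax -/

section Codes

variable {M : Type} [HFModel M]

theorem isOrd_ordN (k : ℕ) : IsOrd (ordN k : M) := by
  induction k with
  | zero => exact .zero
  | succ k ih => exact ih.suc

theorem ordN_mem {i j : ℕ} (h : i < j) : (ordN i : M) ε ordN j := by
  induction j with
  | zero => omega
  | succ j ih =>
    refine (mem_suc_iff ..).2 ?_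
    rcases Nat.lt_succ_iff_lt_or_eq.1 h with h | rfl
    exacts [.inl (ih h), .inr rfl]

theorem isVar_stdVar (i : ℕ) : IsVar (stdVar i : M) := ⟨isOrd_ordN _, ordN_mem (Nat.succ_pos i)⟩

theorem ordNe_stdVar {i j : ℕ} (h : i ≠ j) : OrdNe (stdVar i : M) (stdVar j) :=
  ⟨isOrd_ordN _, isOrd_ordN _, (Nat.lt_or_gt_of_ne h).imp (fun h => ordN_mem (by omega))
    fun h => ordN_mem (by omega)⟩

theorem IsVar.zero_ordNe {x : M} (hx : IsVar x) : OrdNe HFStr.zero x := ⟨.zero, hx.1, .inl hx.2⟩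

/-! ### Terms -/

theorem IsTerm.zero : IsTerm (HFStr.zero : M) := Cl.base (.inl rfl)

theorem IsVar.isTerm {x : M} (hx : IsVar x) : IsTerm x := Cl.base (.inr hx)

theorem IsTerm.eats {a b : M} (ha : IsTerm a) (hb : IsTerm b) : IsTerm (qEats a b) :=
  Cl.step inferInstance inferInstance ha hb rfl

theorem StTerm.self (x u : M) : StTerm x u x u := Cl₂.base (.inl ⟨rfl, rfl⟩)

theorem StTerm.of_ordNe {x u a : M} (h : OrdNe a x) : StTerm x u a a :=
  Cl₂.base (.inr ⟨.inr h, rfl⟩)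

theorem StTerm.ind {x u a : M} (h : IsInd a) : StTerm x u a a := Cl₂.base (.inr ⟨.inl h, rfl⟩)

theorem StTerm.eats {x u a a' b b' : M} (ha : StTerm x u a a') (hb : StTerm x u b b') :
    StTerm x u (qEats a b) (qEats a' b') :=
  Cl₂.step inferInstance inferInstance ha hb ⟨rfl, rfl⟩

theorem Tm.stTerm_code {x u : M} (hx : IsVar x) {ρ ρ' : ℕ → M} {n : ℕ} (t : Tm n)
    (h : ∀ j ∈ t.fv, StTerm x u (ρ j) (ρ' j)) : StTerm x u (t.code ρ) (t.code ρ') := by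
  induction t with
  | zero => exact .of_ordNe hx.zero_ordNe
  | var j => exact h j (by simp [Tm.fv])
  | bnd k => exact .ind ⟨_, isOrd_ordN _, rfl⟩
  | eats t u ht hu =>
    simp only [Tm.fv, Finset.mem_union] at h
    exact .eats (ht fun j hj => h j (.inl hj)) (hu fun j hj => h j (.inr hj))

theorem Tm.code_lift (ρ : ℕ → M) (n : ℕ) (t : Term) : (t.lift n).code ρ = t.code ρ := by
  match t with
  | .zero => rfl
  | .var _ => rfl
  | .bnd k => exact k.elim0
  | .eats t u => simp [Tm.lift, Tm.code, Tm.code_lift ρ n t, Tm.code_lift ρ n u]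

theorem Tm.code_subst (ρ : ℕ → M) (σ : ℕ → Term) {n : ℕ} (t : Tm n) :
    (t.subst σ).code ρ = t.code fun i => (σ i).code ρ := by
  induction t with
  | zero => rfl
  | var i => exact Tm.code_lift ..
  | bnd k => rfl
  | eats t u ht hu => simp [Tm.subst, Tm.code, ht, hu]

theorem Fm.code_subst (ρ : ℕ → M) (σ : ℕ → Term) {n : ℕ} (A : Fm n) :
    (A.subst σ).code ρ = A.code fun i => (σ i).code ρ := by
  induction A with
  | mem t u | eq t u => simp [Fm.subst, Fm.code, Tm.code_subst]
  | disj A B hA hB => simp [Fm.subst, Fm.code, hA, hB]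
  | neg A hA => simp [Fm.subst, Fm.code, hA]
  | ex A hA => simp [Fm.subst, Fm.code, hA]

theorem Tm.code_abst (ρ : ℕ → M) (i : ℕ) {n : ℕ} (t : Tm n) :
    (t.abst i).code ρ = t.code (Function.update ρ i (qInd (ordN n))) := by
  induction t with
  | zero => rfl
  | var j => by_cases h : j = i <;> simp [Tm.abst, Tm.code, h]
  | bnd k => rfl
  | eats t u ht hu => simp [Tm.abst, Tm.code, ht, hu]

theorem Tm.isTerm_code (t : Term) : IsTerm (t.code stdVar : M) := by
  match t with
  | .zero => exact .zero
  | .var i => exact (isVar_stdVar i).isTerm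
  | .bnd k => exact k.elim0
  | .eats t u => exact .eats (Tm.isTerm_code t) (Tm.isTerm_code u)

/-! ### Substitution and abstraction -/

theorem Fm.substForm_code {x u : M} (hx : IsVar x) (hu : IsTerm u) {ρ ρ' : ℕ → M} {n : ℕ}
    (A : Fm n) (h : ∀ j ∈ A.fv, StTerm x u (ρ j) (ρ' j)) :
    SubstForm x u (A.code ρ) (A.code ρ') := by
  refine ⟨hx, hu, ?_⟩
  induction A with
  | mem t t' =>
    simp only [Fm.fv, Finset.mem_union] at h
    exact Cl₂.base ⟨_, _, _, _, ⟨hx, hu, t.stTerm_code hx fun j hj => h j (.inl hj)⟩,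
      ⟨hx, hu, t'.stTerm_code hx fun j hj => h j (.inr hj)⟩, .inr ⟨rfl, rfl⟩⟩
  | eq t t' =>
    simp only [Fm.fv, Finset.mem_union] at h
    exact Cl₂.base ⟨_, _, _, _, ⟨hx, hu, t.stTerm_code hx fun j hj => h j (.inl hj)⟩,
      ⟨hx, hu, t'.stTerm_code hx fun j hj => h j (.inr hj)⟩, .inl ⟨rfl, rfl⟩⟩
  | disj A B hA hB =>
    simp only [Fm.fv, Finset.mem_union] at h
    exact Cl₂.step inferInstance inferInstance (hA fun j hj => h j (.inl hj))
      (hB fun j hj => h j (.inr hj)) (.inl ⟨rfl, rfl⟩)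
  | neg A hA =>
    exact Cl₂.step inferInstance inferInstance (hA h) (hA h) (.inr (.inl ⟨rfl, rfl⟩))
  | ex A hA =>
    exact Cl₂.step inferInstance inferInstance (hA h) (hA h) (.inr (.inr ⟨rfl, rfl⟩))

theorem stTerm_stdVar (i j : ℕ) (u : M) :
    StTerm (stdVar i) u (stdVar j) (Function.update stdVar i u j) := by
  by_cases h : j = i
  · subst h
    simpa using StTerm.self _ _
  · simpa [h] using StTerm.of_ordNe (ordNe_stdVar h)

theorem Tm.abstTerm_code (i : ℕ) {n : ℕ} (t : Tm n) :
    AbstTerm (stdVar i : M) (ordN n) (t.code stdVar) ((t.abst i).code stdVar) := by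
  rw [Tm.code_abst]
  exact ⟨isVar_stdVar i, isOrd_ordN n, t.stTerm_code (isVar_stdVar i) fun j _ =>
    stTerm_stdVar i j _⟩

theorem Fm.abstForm_code (i : ℕ) {n : ℕ} (A : Fm n) :
    AbstForm (stdVar i : M) (ordN n) (A.code stdVar) ((A.abst i).code stdVar) := by
  refine ⟨isVar_stdVar i, isOrd_ordN n, ?_⟩
  have hR : Dfn fun e : ℕ → M => IsOrd (e 0) ∧
      AbstStep (e 0) (e 1) (e 2) (e 3) (e 4) (e 5) (e 6) (e 7) (e 8) := by
    unfold AbstStep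
    infer_instance
  induction A with
  | mem t u =>
    exact Cl₃.base ⟨_, _, _, _, t.abstTerm_code i, u.abstTerm_code i, .inr ⟨rfl, rfl⟩⟩
  | eq t u =>
    exact Cl₃.base ⟨_, _, _, _, t.abstTerm_code i, u.abstTerm_code i, .inl ⟨rfl, rfl⟩⟩
  | disj A B hA hB =>
    exact Cl₃.step inferInstance hR hA hB ⟨isOrd_ordN _, .inl ⟨rfl, rfl, rfl, rfl⟩⟩
  | neg A hA =>
    exact Cl₃.step inferInstance hR hA hA ⟨isOrd_ordN _, .inr (.inl ⟨rfl, rfl, rfl⟩)⟩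
  | ex A hA =>
    exact Cl₃.step inferInstance hR hA hA ⟨isOrd_ordN _, .inr (.inr ⟨rfl, rfl, rfl⟩)⟩

theorem Form.isForm_code (A : Form) : IsForm (A.code stdVar : M) := by
  induction A using Form.induction with
  | mem t u => exact Cl.base ⟨_, _, t.isTerm_code, u.isTerm_code, .inr rfl⟩
  | eq t u => exact Cl.base ⟨_, _, t.isTerm_code, u.isTerm_code, .inl rfl⟩
  | disj A B hA hB => exact Cl.step inferInstance inferInstance hA hB (.inl rfl)
  | neg A hA => exact Cl.step inferInstance inferInstance hA hA (.inr (.inl rfl))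
  | ex A hA =>
    obtain ⟨i, B, -, rfl, hB⟩ := A.exists_abst
    have h := (A.opn (v i)).abstForm_code (M := M) i
    rw [hB] at h
    exact Cl.step inferInstance inferInstance (hA (v i)) (hA (v i)) (.inr (.inr ⟨_, _, h, rfl⟩))

theorem Form.substForm_code (A : Form) (i : ℕ) (t : Term) :
    SubstForm (stdVar i : M) (t.code stdVar) (A.code stdVar) ((A.sub i t).code stdVar) := by
  rw [Fm.sub, Fm.code_subst]
  refine Fm.substForm_code (isVar_stdVar i) t.isTerm_code A fun j _ => ?_
  have h := stTerm_stdVar i j (t.code stdVar : M)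
  by_cases hj : j = i
  · subst hj
    simpa using h
  · simpa [hj, Tm.code] using h

theorem Form.varNonOcc_code {A : Form} {i : ℕ} (h : i ∉ A.fv) :
    VarNonOcc (stdVar i : M) (A.code stdVar) :=
  ⟨A.isForm_code, Fm.substForm_code (isVar_stdVar i) .zero A fun _ hj =>
    .of_ordNe (ordNe_stdVar fun e => h (e ▸ hj))⟩

/-! ### Provability -/

variable {extra : Form}

theorem IsPf.mp {a b : M} (h : IsPf extra (qImp a b)) (ha : IsPf extra a) : IsPf extra b :=
  Cl.step inferInstance inferInstance h ha (.inl rfl)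

theorem IsPf.exists {a b : M} (h : IsPf extra a) (hb : ExistsRule a b) : IsPf extra b :=
  Cl.step inferInstance inferInstance h h (.inr (.inl hb))

theorem IsPf.subst {x t a b : M} (h : IsPf extra a) (hb : SubstForm x t a b) : IsPf extra b :=
  Cl.step inferInstance inferInstance h h (.inr (.inr ⟨x, t, hb⟩))

theorem BooleanAxiom.isBooleanAx_code {A : Form} (h : BooleanAxiom A) :
    IsBooleanAx (A.code stdVar : M) := by
  cases h with
  | ident A =>
    exact ⟨_, _, _, A.isForm_code, A.isForm_code, A.isForm_code, .inl rfl⟩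
  | disjI A B =>
    exact ⟨_, _, _, A.isForm_code, B.isForm_code, A.isForm_code, .inr (.inl rfl)⟩
  | disjCont A =>
    exact ⟨_, _, _, A.isForm_code, A.isForm_code, A.isForm_code, .inr (.inr (.inl rfl))⟩
  | disjAssoc A B C =>
    exact ⟨_, _, _, A.isForm_code, B.isForm_code, C.isForm_code, .inr (.inr (.inr (.inl rfl)))⟩
  | disjConj A B C =>
    exact ⟨_, _, _, A.isForm_code, B.isForm_code, C.isForm_code, .inr (.inr (.inr (.inr rfl)))⟩

theorem SpecialAxiom.isSpecialAx_code {A : Form} (h : SpecialAxiom A) :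
    IsSpecialAx (A.code stdVar : M) := by
  obtain ⟨A, i, t⟩ := h
  exact ⟨_, _, _, _, _, A.isForm_code, A.substForm_code i t, A.abstForm_code i, rfl⟩

theorem InductionAxiom.isInductionAx_code {A : Form} (h : InductionAxiom A) :
    IsInductionAx (A.code stdVar : M) := by
  obtain ⟨A, i, j, hij, hj⟩ := h
  exact ⟨_, _, _, _, _, _, _, _, _, ordNe_stdVar hij, Form.varNonOcc_code hj,
    A.substForm_code i Zero, A.substForm_code i (v j), A.substForm_code i (Eats (v i) (v j)),
    (A IMP (A.sub i (v j) IMP A.sub i (Eats (v i) (v j)))).abstForm_code j,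
    (All j (A IMP (A.sub i (v j) IMP A.sub i (Eats (v i) (v j))))).abstForm_code i,
    A.abstForm_code i, rfl⟩

/-- Theorems are provable in the sense of the model. -/
theorem Thm.isPf_code {H : Set Form} {A : Form} (h : Thm extra H A)
    (hH : ∀ C ∈ H, IsPf extra (C.code stdVar : M)) : IsPf extra (A.code stdVar : M) := by
  induction h with
  | hyp h => exact hH _ h
  | extra => exact Cl.base (.inl rfl)
  | bool h => exact Cl.base (.inr (.inl h.isBooleanAx_code))
  | eq h =>
    refine Cl.base (.inr (.inr (.inl ?_)))
    cases h <;> simp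
  | hf h =>
    refine Cl.base (.inr (.inr (.inr (.inl ?_))))
    cases h <;> simp
  | spec h => exact Cl.base (.inr (.inr (.inr (.inr (.inl h.isSpecialAx_code)))))
  | ind h => exact Cl.base (.inr (.inr (.inr (.inr (.inr h.isInductionAx_code)))))
  | mp _ _ h h' => exact .mp (h fun C hC => hH C (.inl hC)) (h' fun C hC => hH C (.inr hC))
  | exist _ hB _ h =>
    exact (h hH).exists ⟨_, _, _, _, Form.isForm_code _, Form.varNonOcc_code hB,
      Fm.abstForm_code (n := 0) .., rfl, rfl⟩
  | subst _ _ h => exact (h hH).subst (Form.substForm_code ..)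

/-! ## The relation `QR` -/

theorem IsQR.zero : IsQR (HFStr.zero : M) HFStr.zero := Cl₂.base ⟨rfl, rfl⟩

theorem IsQR.eats {a a' b b' : M} (ha : IsQR a a') (hb : IsQR b b') :
    IsQR (a ◁ b) (qEats a' b') :=
  Cl₂.step inferInstance inferInstance ha hb ⟨rfl, rfl⟩

theorem IsQR.ind {P : M → M → Prop} (hP : Dfn fun e => P (e 0) (e 1))
    (zero : P HFStr.zero HFStr.zero)
    (eats : ∀ a a' b b', IsQR a a' → IsQR b b' → P a a' → P b b' → P (a ◁ b) (qEats a' b'))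
    {x x' : M} (h : IsQR x x') : P x x' := by
  have inst (f g : (ℕ → M) → M) [DTm f] [DTm g] : Dfn fun e => P (f e) (g e) := hP.comp₂ f g
  refine (Cl₂.ind (P := fun x x' => IsQR x x' ∧ P x x') inferInstance ?_ ?_ h).2
  · rintro _ _ ⟨rfl, rfl⟩
    exact ⟨.zero, zero⟩
  · rintro _ _ b b' c c' ⟨rfl, rfl⟩ hb hc
    exact ⟨hb.1.eats hc.1, eats _ _ _ _ hb.1 hc.1 hb.2 hc.2⟩

theorem IsQR.isTerm {x x' : M} (h : IsQR x x') : IsTerm x' :=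
  IsQR.ind (P := fun _ x' => IsTerm x') inferInstance .zero (fun _ _ _ _ _ _ => .eats) h

theorem IsQR.substTerm {x x' i u : M} (h : IsQR x x') (hi : IsVar i) (hu : IsTerm u) :
    SubstTerm i u x' x' :=
  IsQR.ind (P := fun _ x' => SubstTerm i u x' x') inferInstance
    ⟨hi, hu, .of_ordNe hi.zero_ordNe⟩
    (fun _ _ _ _ _ _ ha hb => ⟨hi, hu, .eats ha.2.2 hb.2.2⟩) h

/-- Codes of sets can be substituted for the variables of a theorem. -/
theorem Pr.isPf_code {A : Form} (hA : Pr extra A) (ρ : ℕ → M) (S : Finset ℕ)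
    (hρ : ∀ i ∈ S, ∃ x, IsQR x (ρ i)) :
    IsPf extra (A.code fun i => if i ∈ S then ρ i else stdVar i) := by
  induction S using Finset.induction_on with
  | empty => simpa using Thm.isPf_code hA fun C hC => hC.elim
  | insert a S ha ih =>
    obtain ⟨x, hx⟩ := hρ a (Finset.mem_insert_self ..)
    refine (ih fun i hi => hρ i (Finset.mem_insert_of_mem hi)).subst
      (Fm.substForm_code (isVar_stdVar a) hx.isTerm A fun j _ => ?_)
    by_cases hj : j ∈ S
    · obtain ⟨y, hy⟩ := hρ j (Finset.mem_insert_of_mem hj)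
      simpa [hj] using (hy.substTerm (isVar_stdVar a) hx.isTerm).2.2
    · by_cases hja : j = a
      · subst hja
        simpa [hj] using StTerm.self _ _
      · simpa [hj, hja] using StTerm.of_ordNe (ordNe_stdVar hja)

theorem Pr.isPf_code₃ {A : Form} (hA : Pr extra A) {x x' y y' z z' : M} (hx : IsQR x x')
    (hy : IsQR y y') (hz : IsQR z z') :
    IsPf extra (A.code fun i => if i = 0 then x' else if i = 1 then y' else if i = 2 then z' else
      stdVar i) := by
  convert hA.isPf_code (fun i => if i = 0 then x' else if i = 1 then y' else z') {0, 1, 2} ?_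
    using 3 with i
  · split_ifs <;> simp_all
  · intro i _
    split_ifs
    exacts [⟨x, hx⟩, ⟨y, hy⟩, ⟨z, hz⟩]

def qSub (t u : M) : M := qAll (qImp (qMem (qInd HFStr.zero) t) (qMem (qInd HFStr.zero) u))

instance DTm.qSub (f g : (ℕ → M) → M) [DTm f] [DTm g] : DTm fun e => qSub (f e) (g e) :=
  inferInstanceAs (DTm fun e => HFCalc.qNeg (HFCalc.qEx (HFCalc.qNeg (HFCalc.qImp
    (HFCalc.qMem (HFCalc.qInd HFStr.zero) (f e)) (HFCalc.qMem (HFCalc.qInd HFStr.zero) (g e))))))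

theorem code_Subset (ρ : ℕ → M) (t u : Term) :
    (t SUBS u).code ρ = qSub (t.code ρ) (u.code ρ) := by
  rw [Subset, inst, Fm.code_subst]
  rfl

theorem isPf_mem_eats_left {a a' b b' c c' : M} (ha : IsQR a a') (hb : IsQR b b')
    (hc : IsQR c c') (h : IsPf extra (qMem a' b')) : IsPf extra (qMem a' (qEats b' c')) :=
  IsPf.mp (Pr.isPf_code₃ (completeness (A := v 0 IN v 1 IMP v 0 IN Eats (v 1) (v 2))
    fun M _ ρ => by simpa using Or.inl) ha hb hc) h

theorem isPf_mem_eats_right {a a' b b' c c' : M} (ha : IsQR a a') (hb : IsQR b b')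
    (hc : IsQR c c') (h : IsPf extra (qEq a' c')) : IsPf extra (qMem a' (qEats b' c')) :=
  IsPf.mp (Pr.isPf_code₃ (completeness (A := v 0 EQ v 2 IMP v 0 IN Eats (v 1) (v 2))
    fun M _ ρ => by simpa using Or.inr) ha hb hc) h

theorem isPf_zero_sub {a a' : M} (ha : IsQR a a') : IsPf extra (qSub HFStr.zero a') := by
  have h := Pr.isPf_code₃ (extra := extra) (completeness (A := Zero SUBS v 0)
    fun M _ ρ => by simp [IsSub]) ha ha ha
  rwa [code_Subset] at h

theorem isPf_eats_sub {a a' b b' c c' : M} (ha : IsQR a a') (hb : IsQR b b')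
    (hc : IsQR c c') (h : IsPf extra (qSub a' c')) (h' : IsPf extra (qMem b' c')) :
    IsPf extra (qSub (qEats a' b') c') := by
  have key := Pr.isPf_code₃ (extra := extra) (completeness
    (A := v 0 SUBS v 2 IMP (v 1 IN v 2 IMP Eats (v 0) (v 1) SUBS v 2))
    fun M _ ρ => by
      simp only [holds_imp, holds_Subset, holds_mem, val_var, val_eats]
      intro h h' z hz
      rcases (mem_eats_iff ..).1 hz with hz | rfl
      exacts [h z hz, h']) ha hb hc
  simp only [Imp, Fm.code, code_Subset] at key
  exact (IsPf.mp key h).mp h'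

theorem isPf_eq {a a' b b' : M} (ha : IsQR a a') (hb : IsQR b b')
    (h : IsPf extra (qSub a' b')) (h' : IsPf extra (qSub b' a')) : IsPf extra (qEq a' b') := by
  have key := Pr.isPf_code₃ (extra := extra) (completeness
    (A := v 0 SUBS v 1 IMP (v 1 SUBS v 0 IMP v 0 EQ v 1))
    fun M _ ρ => by
      simp only [holds_imp, holds_Subset, holds_eq, val_var]
      exact fun h h' => set_ext fun u => ⟨h u, h' u⟩) ha hb hb
  simp only [Imp, Fm.code, code_Subset] at key
  exact (IsPf.mp key h).mp h'

/-- True instances of membership and inclusion, in both directions, are provable. -/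
def Reflects (extra : Form) (x x' y y' : M) : Prop :=
  (x ε y → IsPf extra (qMem x' y')) ∧ (y ε x → IsPf extra (qMem y' x')) ∧
    (IsSub x y → IsPf extra (qSub x' y')) ∧ (IsSub y x → IsPf extra (qSub y' x'))

theorem Reflects.symm {x x' y y' : M} (h : Reflects extra x x' y y') :
    Reflects extra y y' x x' := ⟨h.2.1, h.1, h.2.2.2, h.2.2.1⟩

theorem Reflects.eq {x x' y y' : M} (h : Reflects extra x x' y y') (hx : IsQR x x')
    (hy : IsQR y y') (e : x = y) : IsPf extra (qEq x' y') := by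
  subst e
  exact isPf_eq hx hy (h.2.2.1 fun _ => id) (h.2.2.2 fun _ => id)

theorem isPf_mem_eats {x x' a a' b b' : M} (hx : IsQR x x') (ha : IsQR a a') (hb : IsQR b b')
    (hxa : Reflects extra x x' a a') (hxb : Reflects extra x x' b b') (h : x ε a ◁ b) :
    IsPf extra (qMem x' (qEats a' b')) := by
  rcases (mem_eats_iff ..).1 h with h | h
  · exact isPf_mem_eats_left hx ha hb (hxa.1 h)
  · exact isPf_mem_eats_right hx ha hb (hxb.eq hx hb h)

theorem isPf_eats_sub_of_reflects {x x' a a' b b' : M} (hx : IsQR x x') (ha : IsQR a a')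
    (hb : IsQR b b') (hxa : Reflects extra x x' a a') (hxb : Reflects extra x x' b b')
    (h : IsSub (a ◁ b) x) : IsPf extra (qSub (qEats a' b') x') :=
  isPf_eats_sub ha hb hx (hxa.2.2.2 fun z hz => h z ((mem_eats_iff ..).2 (.inl hz)))
    (hxb.2.1 (h b ((mem_eats_iff ..).2 (.inr rfl))))

instance Dfn.reflects (f g k l : (ℕ → M) → M) [DTm f] [DTm g] [DTm k] [DTm l] :
    Dfn fun e => Reflects extra (f e) (g e) (k e) (l e) :=
  inferInstanceAs (Dfn fun e => (f e ε k e → IsPf extra (qMem (g e) (l e))) ∧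
    (k e ε f e → IsPf extra (qMem (l e) (g e))) ∧
    (IsSub (f e) (k e) → IsPf extra (qSub (g e) (l e))) ∧
    (IsSub (k e) (f e) → IsPf extra (qSub (l e) (g e))))

theorem IsQR.reflects {x x' y y' : M} (hx : IsQR x x') (hy : IsQR y y') :
    Reflects extra x x' y y' := by
  refine IsQR.ind (P := fun x x' => ∀ y y', IsQR y y' → Reflects extra x x' y y') inferInstance
    ?_ ?_ hx y y' hy
  · intro y y' hy
    refine IsQR.ind (P := fun y y' => Reflects extra HFStr.zero HFStr.zero y y') inferInstance
      ?_ ?_ hy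
    · exact ⟨by simp, by simp, fun _ => isPf_zero_sub .zero, fun _ => isPf_zero_sub .zero⟩
    · intro a a' b b' ha hb iha ihb
      exact ⟨isPf_mem_eats .zero ha hb iha ihb, by simp, fun _ => isPf_zero_sub (ha.eats hb),
        isPf_eats_sub_of_reflects .zero ha hb iha ihb⟩
  · intro a a' b b' ha hb iha ihb y y' hy
    have hab := ha.eats hb
    refine IsQR.ind (P := fun y y' => IsQR y y' → Reflects extra (a ◁ b) (qEats a' b') y y')
      inferInstance ?_ ?_ hy hy
    · intro h0
      have h1 := (iha _ _ h0).symm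
      have h2 := (ihb _ _ h0).symm
      exact ⟨by simp, isPf_mem_eats .zero ha hb h1 h2, isPf_eats_sub_of_reflects .zero ha hb h1 h2,
        fun _ => isPf_zero_sub hab⟩
    · intro c c' d d' hc hd ihc ihd h
      have h1 := (iha _ _ h).symm
      have h2 := (ihb _ _ h).symm
      exact ⟨isPf_mem_eats hab hc hd (ihc hc) (ihd hd), isPf_mem_eats h ha hb h1 h2,
        isPf_eats_sub_of_reflects h ha hb h1 h2,
        isPf_eats_sub_of_reflects hab hc hd (ihc hc) (ihd hd)⟩

end Codes

theorem Thm.of_holds {extra A B C : Form}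
    (h : ∀ (M : Type) [HFModel M] (ρ : ℕ → M), Holds ρ A → Holds ρ B → Holds ρ C) :
    Thm extra {A, B} C := by
  have h1 : Pr extra (A IMP (B IMP C)) := completeness fun M _ ρ => by simpa using h M ρ
  have h2 : Thm extra {A, B} (B IMP C) := by
    simpa using Thm.mp (h1.weaken (H := {A, B})) (.hyp (H := {A, B}) (by simp))
  simpa using Thm.mp h2 (.hyp (H := {A, B}) (by simp))

end HFCalc

open HFCalc in
theorem mainTheorem4 (extra : HFCalc.Form) (x x' y y' : ℕ) :
    HFCalc.Thm extra {HFCalc.QR (.var x) (.var x'), HFCalc.QR (.var y) (.var y')}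
      (.var x IN .var y IMP
        HFCalc.PfP extra ((.var x' IN .var y').vquot {x', y'})) ∧
    HFCalc.Thm extra {HFCalc.QR (.var x) (.var x'), HFCalc.QR (.var y) (.var y')}
      (.var x SUBS .var y IMP
        HFCalc.PfP extra ((.var x' SUBS .var y').vquot {x', y'})) ∧
    HFCalc.Thm extra {HFCalc.QR (.var x) (.var x'), HFCalc.QR (.var y) (.var y')}
      (.var x EQ .var y IMP
        HFCalc.PfP extra ((.var x' EQ .var y').vquot {x', y'})) := by
  refine ⟨Thm.of_holds fun M _ ρ hx hy => ?_, Thm.of_holds fun M _ ρ hx hy => ?_,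
    Thm.of_holds fun M _ ρ hx hy => ?_⟩ <;>
  rw [holds_QR] at hx hy <;>
  have h := IsQR.reflects (extra := extra) hx hy <;>
  rw [holds_imp, holds_PfP, Fm.val_vquot]
  · simpa [Fm.code, Tm.code] using h.1
  · simpa [code_Subset, Tm.code] using h.2.2.1
  · simpa [Fm.code, Tm.code] using h.eq hx hy
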